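/- Let $Y$ be a Banach space, $A,B$ bounded linear operators on $Y$ with $AB=BA$, let $1<\alpha\le 2$, $0<\beta\le 1$, $T>0$, $J=[0,T]$, $\eta,\hat\eta\in Y$, and let $g:J\to Y$ be continuous. Consider the Cauchy problem $$({}^{C}D^{\alpha}_{0+}x)(t)-A\,({}^{C}D^{\beta}_{0+}x)(t)=Bx(t)+g(t)\quad(0<t\le T),\qquad x(0)=\eta,\quad x'(0)=\hat\eta, \tag{1}$$ and put, for $t\in J$, $$\begin{aligned}\hat x(t)={}&\Bigl(I+\sum_{k=0}^\infty\sum_{m=0}^\infty\binom{k+m}{m}A^kB^{m+1}\frac{t^{k(\alpha-\beta)+m\alpha+\alpha}}{\Gamma(k(\alpha-\beta)+m\alpha+\alpha+1)}\Bigr)\eta+\sum_{k=0}^\infty\sum_{m=0}^\infty\binom{k+m}{m}A^kB^m\frac{t^{k(\alpha-\beta)+m\alpha+1}}{\Gamma(k(\alpha-\beta)+m\alpha+2)}\,\hat\eta\\&+\int_0^t\sum_{k=0}^\infty\sum_{m=0}^\infty\binom{k+m}{m}A^kB^m\frac{(t-s)^{k(\alpha-\beta)+m\alpha+\alpha-1}}{\Gamma(k(\alpha-\beta)+m\alpha+\alpha)}\,g(s)\,ds.\end{aligned}\tag{2}$$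 Here, for $n-1<\nu\le n$, $({}^{C}D^{\nu}_{0+}x)(t)=\frac{d^n}{dt^n}\,I^{n-\nu}_{0+}\bigl(x-\sum_{k<n}\frac{x^{(k)}(0)}{k!}(\cdot)^k\bigr)(t)$, where $(I^{\mu}_{0+}f)(t)=\frac1{\Gamma(\mu)}\int_0^t(t-s)^{\mu-1}f(s)\,ds$ for $\mu>0$ and $I^0_{0+}f=f$. A solution of (1) is a function $x\in C^1(J,Y)$ with $x(0)=\eta$, $x'(0)=\hat\eta$, for which both derivatives exist and the equation holds at every $t\in(0,T]$ (all derivatives at $t=T$, and ordinary derivatives at $t=0$, are one-sided). A mild solution of (1) is a function $x\in C(J,Y)$ with $$x(t)=\eta-\frac{t^{\alpha-\beta}}{\Gamma(\alpha-\beta+1)}A\eta+t\hat\eta+\frac1{\Gamma(\alpha-\beta)}\int_0^t(t-r)^{\alpha-\beta-1}Ax(r)\,dr+\frac1{\Gamma(\alpha)}\int_0^t(t-r)^{\alpha-1}\bigl(Bx(r)+g(r)\bigr)dr,\quad t\in J.$$ Then: (a) for all $t\in J$ and $\delta\in\{\alpha,1,\alpha-1\}$ the double series $\sum_{k,m}\binom{k+m}{m}A^kB^m\,t^{k(\alpha-\beta)+m\alpha+\delta}/\Gamma(k(\alpha-\beta)+m\alpha+\delta+1)$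 converges absolutely in operator norm, and the integrand in (2) is integrable on $[0,t]$; (b) $\hat x$ is a solution of (1), and every solution of (1) is equal to $\hat x$ on $J$; (c) $\hat x$ is a mild solution of (1), and every mild solution of (1) is equal to $\hat x$ on $J$; (d) a function $x\in C^2(J,Y)$ satisfies (1) with the Caputo derivatives $({}^{C}D^{\nu}_{0+}x)(t)=(I^{n-\nu}_{0+}x^{(n)})(t)$ ($n-1<\nu\le n$) if and only if $x=\hat x$ on $J$. -/

import Mathlib

open Set MeasureTheory

noncomputable section

namespace FracEvol

variable {Y : Type*} [NormedAddCommGroup Y] [NormedSpace ℝ Y]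

/-- The Riemann–Liouville fractional integral with lower limit `0`,
`(I^μ f)(t) = (1/Γ(μ)) ∫₀ᵗ (t-s)^(μ-1) f(s) ds` (Bochner integral) for `μ > 0`, and `I^0 f = f`. -/
def fracIntegral (μ : ℝ) (f : ℝ → Y) (t : ℝ) : Y :=
  if μ = 0 then f t
  else (Real.Gamma μ)⁻¹ • ∫ s in (0 : ℝ)..t, (t - s) ^ (μ - 1) • f s

/-- `f` has at `t ∈ (0, T]` the Riemann–Liouville derivative `v` of order `ν > 0`: with
`n = ⌈ν⌉`, i.e. `n - 1 < ν ≤ n`, the function `I^(n-ν) f` is `n - 1` times differentiable on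
`(0, T]`, and its derivative of order `n - 1` is differentiable at `t` with derivative `v`
(one-sided at `t = T`). -/
def HasRLDeriv (T ν : ℝ) (f : ℝ → Y) (v : Y) (t : ℝ) : Prop :=
  (∀ i : ℕ, i + 1 < ⌈ν⌉₊ → DifferentiableOn ℝ
      (iteratedDerivWithin i (fracIntegral (⌈ν⌉₊ - ν) f) (Ioc 0 T)) (Ioc 0 T)) ∧
    HasDerivWithinAt
      (iteratedDerivWithin (⌈ν⌉₊ - 1) (fracIntegral (⌈ν⌉₊ - ν) f) (Ioc 0 T)) v (Ioc 0 T) t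

/-- `f` has at `t ∈ (0, T]` the Caputo derivative `v` of order `ν > 0`: this is the
Riemann–Liouville derivative of `f(s) - ∑_{k < n} s^k / k! • f^(k)(0)`, with `n = ⌈ν⌉`.
It is used for functions which are `n - 1` times differentiable on `[0, T]`. -/
def HasCaputoDeriv (T ν : ℝ) (f : ℝ → Y) (v : Y) (t : ℝ) : Prop :=
  HasRLDeriv T ν
    (fun s => f s - ∑ k ∈ Finset.range ⌈ν⌉₊,
      (s ^ k / (k.factorial : ℝ)) • iteratedDerivWithin k f (Icc 0 T) 0) v t

/-- The Caputo derivative `(1/Γ(n-ν)) ∫₀ᵗ (t-s)^(n-ν-1) f^(n)(s) ds`, `n = ⌈ν⌉`, of a function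
which is `n` times continuously differentiable on `[0, T]`
(for `ν = n` it is the ordinary derivative `f^(n)(t)`). -/
def classicalCaputoDeriv (T ν : ℝ) (f : ℝ → Y) (t : ℝ) : Y :=
  fracIntegral (⌈ν⌉₊ - ν) (iteratedDerivWithin ⌈ν⌉₊ f (Icc 0 T)) t

/-- `x` is a solution on `[0, T]` of the Cauchy problem
`D^α x - A D^β x = B x + g` for `t > 0`, `x(0) = η`, `x'(0) = η'`:
it is continuously differentiable on `[0, T]`, satisfies the initial conditions, and at every
`t ∈ (0, T]` its Caputo derivatives of orders `α` and `β` exist and satisfy the equation. -/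
def IsSolution (A B : Y →L[ℝ] Y) (α β T : ℝ) (η η' : Y) (g x : ℝ → Y) : Prop :=
  ContDiffOn ℝ 1 x (Icc 0 T) ∧ x 0 = η ∧ derivWithin x (Icc 0 T) 0 = η' ∧
    ∀ t ∈ Ioc 0 T, ∃ a b : Y, HasCaputoDeriv T α x a t ∧ HasCaputoDeriv T β x b t ∧
      a - A b = B (x t) + g t

/-- `x` solves the same Cauchy problem, with the Caputo derivatives given by the classical
integral formula; this is used for `x` twice continuously differentiable on `[0, T]`. -/
def IsClassicalSolution (A B : Y →L[ℝ] Y) (α β T : ℝ) (η η' : Y) (g x : ℝ → Y) : Prop :=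
  x 0 = η ∧ derivWithin x (Icc 0 T) 0 = η' ∧
    ∀ t ∈ Ioc 0 T, classicalCaputoDeriv T α x t - A (classicalCaputoDeriv T β x t)
      = B (x t) + g t

/-- `x` is a mild solution on `[0, T]` of the same Cauchy problem: it is continuous and satisfies
the associated Volterra integral equation. -/
def IsMildSolution (A B : Y →L[ℝ] Y) (α β T : ℝ) (η η' : Y) (g x : ℝ → Y) : Prop :=
  ContinuousOn x (Icc 0 T) ∧
    ∀ t ∈ Icc 0 T, x t =
      η - (t ^ (α - β) / Real.Gamma (α - β + 1)) • A η + t • η'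
        + (Real.Gamma (α - β))⁻¹ • (∫ r in (0 : ℝ)..t, (t - r) ^ (α - β - 1) • A (x r))
        + (Real.Gamma α)⁻¹ • (∫ r in (0 : ℝ)..t, (t - r) ^ (α - 1) • (B (x r) + g r))

/-- `C(k+m, m) A^k B^m t^(k(α-β)+mα+δ) / Γ(k(α-β)+mα+δ+1)`. -/
def permTerm (A B : Y →L[ℝ] Y) (α β δ t : ℝ) (k m : ℕ) : Y →L[ℝ] Y :=
  (((k + m).choose m : ℝ) *
      (t ^ ((k : ℝ) * (α - β) + (m : ℝ) * α + δ) /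
        Real.Gamma ((k : ℝ) * (α - β) + (m : ℝ) * α + δ + 1))) • (A ^ k * B ^ m)

/-- The sum over `k`, `m` of `permTerm`. -/
def permSeries (A B : Y →L[ℝ] Y) (α β δ t : ℝ) : Y →L[ℝ] Y :=
  ∑' k : ℕ, ∑' m : ℕ, permTerm A B α β δ t k m

/-- The representation formula
`(I + ∑ₖ ∑ₘ C(k+m,m) A^k B^(m+1) t^(k(α-β)+mα+α) / Γ(k(α-β)+mα+α+1)) η
  + ∑ₖ ∑ₘ C(k+m,m) A^k B^m t^(k(α-β)+mα+1) / Γ(k(α-β)+mα+2) η'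
  + ∫₀ᵗ ∑ₖ ∑ₘ C(k+m,m) A^k B^m (t-s)^(k(α-β)+mα+α-1) / Γ(k(α-β)+mα+α) g(s) ds`. -/
def permFormula (A B : Y →L[ℝ] Y) (α β : ℝ) (η η' : Y) (g : ℝ → Y) (t : ℝ) : Y :=
  (1 + ∑' k : ℕ, ∑' m : ℕ, permTerm A B α β α t k m * B) η
    + permSeries A B α β 1 t η'
    + ∫ s in (0 : ℝ)..t, permSeries A B α β (α - 1) (t - s) (g s)

end FracEvol

end

/-! ### Scalar majorants and absolute convergence of the double series. -/

noncomputable section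

namespace FracEvol

/-! Put `γ = α - β` and `u = x - η`. The Cauchy problem integrates to the Volterra equation `u = t
η' + I^α (B η + g) + A I^γ u + B I^α u` in `C([0, T], Y)`; passing from `x` to `u` absorbs the term
`-t^γ / Γ(γ+1) A η` of the mild form.

Fractional integrals form a semigroup (`rlIntegral_rlIntegral`) and commute with bounded operators
on `Y`. As `AB = BA`, the operators `P = A I^γ` and `Q = B I^α` commute, and `P^k Q^m = A^k B^m
I^(kγ+mα)` has norm at most `‖A‖^k ‖B‖^m T^(kγ+mα) / Γ(kγ+mα+1)`. Hence `∑ C(k+m,m) P^k Q^m = ∑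
(P+Q)^n` converges with no smallness condition on `T`, and it is a two-sided inverse of `1 - (P+Q)`:
the Volterra equation has exactly one solution (`eq_resolventSeries_apply_iff`). Evaluated term by
term on the inhomogeneity, this inverse is the representation formula
(`permFormula_eq_add_resolventSeries`).

It remains to identify each notion of solution with the Volterra equation. For mild solutions this
is algebra. For solutions (`isSolution_iff`), write `x = x(0) + I^1 f`: the derivative of order `β`
is `I^(1-β) f` and that of order `α` is the derivative of `I^(2-α) (f - f(0))`, so the equation can
be integrated once and then hit with `I^(α-1)`. The converse needs a continuous Volterra solution to
be `C¹`, which is not evident when `γ < 1`; iterating the equation gives it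
(`exists_eq_rlIntegral_one_of_eq_add`). For `C²` functions the two Caputo derivatives coincide. -/

/-- Restricting the Gamma integral to `x > t`, where `x^s ≥ t^s`, leaves at least `t^s e^(-t)`. -/
theorem rpow_div_Gamma_le_exp {t s : ℝ} (ht : 0 ≤ t) (hs : 0 ≤ s) :
    t ^ s / Real.Gamma (s + 1) ≤ Real.exp t := by
  have hpos : 0 < s + 1 := by linarith
  rw [div_le_iff₀ (Real.Gamma_pos_of_pos hpos), Real.Gamma_eq_integral hpos, add_sub_cancel_right]
  have hint := Real.GammaIntegral_convergent hpos
  rw [add_sub_cancel_right] at hint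
  have h1 : ∫ x in Ioi t, Real.exp (-x) * t ^ s ≤ ∫ x in Ioi t, Real.exp (-x) * x ^ s := by
    refine setIntegral_mono_on ?_ (hint.mono_set (Ioi_subset_Ioi ht)) measurableSet_Ioi ?_
    · exact (integrableOn_exp_neg_Ioi t).mul_const _
    · intro x hx
      have : t ^ s ≤ x ^ s := Real.rpow_le_rpow ht (le_of_lt hx) hs
      gcongr
  have h2 : ∫ x in Ioi t, Real.exp (-x) * x ^ s ≤ ∫ x in Ioi (0 : ℝ), Real.exp (-x) * x ^ s := by
    refine setIntegral_mono_set hint ?_ (Filter.Eventually.of_forall (Ioi_subset_Ioi ht))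
    filter_upwards [ae_restrict_mem measurableSet_Ioi] with x hx
    have : (0 : ℝ) < x := hx
    positivity
  rw [integral_mul_const, integral_exp_neg_Ioi] at h1
  calc t ^ s = Real.exp t * (Real.exp (-t) * t ^ s) := by
        rw [← mul_assoc, ← Real.exp_add]; simp
    _ ≤ _ := by gcongr; exact h1.trans h2

/-- The exponential bound is used at `R t` instead of `t`: the spare factor `R^(-σ)` beats all
geometric growth, since `σ ≥ (k+m) γ`. -/
theorem summable_choose_mul_rpow_div_Gamma {a b γ ρ δ t : ℝ} (ha : 0 ≤ a) (hb : 0 ≤ b)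
    (hγ : 0 < γ) (hγρ : γ ≤ ρ) (hδ : 0 ≤ δ) (ht : 0 ≤ t) :
    Summable fun p : ℕ × ℕ => ((p.1 + p.2).choose p.2 : ℝ) *
      (t ^ ((p.1 : ℝ) * γ + (p.2 : ℝ) * ρ + δ) /
        Real.Gamma ((p.1 : ℝ) * γ + (p.2 : ℝ) * ρ + δ + 1)) * (a ^ p.1 * b ^ p.2) := by
  set c := max a b
  have hc : 0 ≤ c := le_max_of_le_left ha
  -- One factor 2 pays for the binomial coefficient, the other leaves the ratio 1/2; `R` is chosen
  -- so that `R^γ = K`.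
  set K := 4 * (c + 1) with hK
  have hK1 : 1 ≤ K := by linarith
  set R := K ^ (1 / γ)
  have hR1 : 1 ≤ R := Real.one_le_rpow hK1 (by positivity)
  have hRγ : R ^ γ = K := by
    rw [← Real.rpow_mul (by linarith)]; field_simp; simp
  have hgeo : Summable fun p : ℕ × ℕ => ((1 : ℝ) / 2) ^ p.1 * (1 / 2) ^ p.2 :=
    (summable_geometric_two).mul_of_nonneg summable_geometric_two
      (fun _ => by positivity) (fun _ => by positivity)
  have hρ : 0 < ρ := hγ.trans_le hγρ
  refine Summable.of_nonneg_of_le (fun p => ?_) (fun p => ?_) (hgeo.mul_left (Real.exp (R * t)))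
  · have : 0 < Real.Gamma ((p.1 : ℝ) * γ + (p.2 : ℝ) * ρ + δ + 1) :=
      Real.Gamma_pos_of_pos (by positivity)
    positivity
  · obtain ⟨k, m⟩ := p
    simp only
    set σ := (k : ℝ) * γ + (m : ℝ) * ρ + δ with hσ
    have hσ0 : 0 ≤ σ := by positivity
    have hG : 0 < Real.Gamma (σ + 1) := Real.Gamma_pos_of_pos (by positivity)
    have h1 : ((k + m).choose m : ℝ) ≤ 2 ^ (k + m) := by
      exact_mod_cast Nat.choose_le_two_pow _ _
    have h2 : a ^ k * b ^ m ≤ (c + 1) ^ (k + m) := by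
      rw [pow_add]
      have : a ≤ c + 1 := (le_max_left a b).trans (by linarith)
      have : b ≤ c + 1 := (le_max_right a b).trans (by linarith)
      gcongr
    have h3 : K ^ (k + m) ≤ R ^ σ := by
      rw [← hRγ, ← Real.rpow_natCast, ← Real.rpow_mul (by linarith)]
      refine Real.rpow_le_rpow_of_exponent_le hR1 ?_
      rw [hσ]; push_cast
      nlinarith [mul_le_mul_of_nonneg_left hγρ (Nat.cast_nonneg (α := ℝ) m)]
    have h4 := rpow_div_Gamma_le_exp (t := R * t) (by positivity) hσ0
    rw [Real.mul_rpow (by linarith) ht] at h4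
    have h5 : ((k + m).choose m : ℝ) * (a ^ k * b ^ m) ≤ (1 / 2) ^ k * (1 / 2) ^ m * R ^ σ := by
      calc ((k + m).choose m : ℝ) * (a ^ k * b ^ m) ≤ 2 ^ (k + m) * (c + 1) ^ (k + m) := by gcongr
        _ = (1 / 2) ^ k * (1 / 2) ^ m * K ^ (k + m) := by
          rw [← pow_add, ← mul_pow, ← mul_pow, hK]; congr 1; ring
        _ ≤ _ := by gcongr
    calc ((k + m).choose m : ℝ) * (t ^ σ / Real.Gamma (σ + 1)) * (a ^ k * b ^ m)
        = (((k + m).choose m : ℝ) * (a ^ k * b ^ m)) * (t ^ σ / Real.Gamma (σ + 1)) := by ring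
      _ ≤ ((1 / 2) ^ k * (1 / 2) ^ m * R ^ σ) * (t ^ σ / Real.Gamma (σ + 1)) := by gcongr
      _ = (1 / 2) ^ k * (1 / 2) ^ m * (R ^ σ * t ^ σ / Real.Gamma (σ + 1)) := by ring
      _ ≤ (1 / 2) ^ k * (1 / 2) ^ m * Real.exp (R * t) := by gcongr
      _ = _ := by ring

theorem norm_pow_mul_pow_le {E : Type*} [NormedAddCommGroup E] [NormedSpace ℝ E]
    (A B : E →L[ℝ] E) (k m : ℕ) : ‖A ^ k * B ^ m‖ ≤ ‖A‖ ^ k * ‖B‖ ^ m := by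
  have h (C : E →L[ℝ] E) (n : ℕ) : ‖C ^ n‖ ≤ ‖C‖ ^ n := by
    -- On a trivial space `‖1‖ = 0`, so the zeroth power is only bounded by 1.
    rcases n.eq_zero_or_pos with rfl | hn
    · rw [pow_zero, pow_zero]; exact ContinuousLinearMap.norm_id_le
    · exact norm_pow_le' C hn
  exact (norm_mul_le _ _).trans (mul_le_mul (h A k) (h B m) (norm_nonneg _) (by positivity))

variable {Y : Type*} [NormedAddCommGroup Y] [NormedSpace ℝ Y]

theorem norm_permTerm_le (A B : Y →L[ℝ] Y) {α β δ t : ℝ} (hα : 0 ≤ α) (hβ : β ≤ α) (hδ : 0 ≤ δ)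
    (ht : 0 ≤ t) (k m : ℕ) : ‖permTerm A B α β δ t k m‖ ≤ ((k + m).choose m : ℝ) *
      (t ^ ((k : ℝ) * (α - β) + (m : ℝ) * α + δ) /
        Real.Gamma ((k : ℝ) * (α - β) + (m : ℝ) * α + δ + 1)) * (‖A‖ ^ k * ‖B‖ ^ m) := by
  have h0 : 0 ≤ (k : ℝ) * (α - β) + (m : ℝ) * α + δ := by
    have := sub_nonneg.2 hβ
    positivity
  have hG := Real.Gamma_pos_of_pos (add_pos_of_nonneg_of_pos h0 one_pos)
  rw [permTerm, norm_smul, Real.norm_of_nonneg (by positivity)]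
  gcongr
  exact norm_pow_mul_pow_le A B k m

theorem summable_norm_permTerm (A B : Y →L[ℝ] Y) {α β δ t : ℝ} (hβ : 0 ≤ β) (hβα : β < α)
    (hδ : 0 ≤ δ) (ht : 0 ≤ t) :
    Summable fun p : ℕ × ℕ => ‖permTerm A B α β δ t p.1 p.2‖ :=
  Summable.of_nonneg_of_le (fun _ => norm_nonneg _)
    (fun p => norm_permTerm_le A B (hβ.trans hβα.le) hβα.le hδ ht p.1 p.2)
    (summable_choose_mul_rpow_div_Gamma (norm_nonneg A) (norm_nonneg B) (sub_pos.2 hβα)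
      (sub_le_self _ hβ) hδ ht)

end FracEvol
end

/-! ### Riemann–Liouville integration as a semigroup of operators on `C([0, T], Y)`. -/

noncomputable section

namespace FracEvol

variable {Y : Type*} [NormedAddCommGroup Y] [NormedSpace ℝ Y]

theorem intervalIntegrable_one_sub_rpow {μ : ℝ} (hμ : 0 < μ) :
    IntervalIntegrable (fun σ : ℝ => (1 - σ) ^ (μ - 1)) volume 0 1 := by
  have := (intervalIntegral.intervalIntegrable_rpow' (a := 1) (b := 0)
    (by linarith : -1 < μ - 1)).comp_sub_left 1
  simpa using this

theorem integral_one_sub_rpow {μ : ℝ} (hμ : 0 < μ) :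
    ∫ σ in (0 : ℝ)..1, (1 - σ) ^ (μ - 1) = 1 / μ := by
  rw [intervalIntegral.integral_comp_sub_left (fun x : ℝ => x ^ (μ - 1)),
    integral_rpow (Or.inl (by linarith))]
  simp [Real.zero_rpow hμ.ne']

theorem intervalIntegrable_one_sub_rpow_smul {μ : ℝ} (hμ : 0 < μ) {f : ℝ → Y}
    (hf : Continuous f) :
    IntervalIntegrable (fun σ : ℝ => (1 - σ) ^ (μ - 1) • f σ) volume 0 1 :=
  (intervalIntegrable_one_sub_rpow hμ).smul_continuousOn hf.continuousOn

theorem norm_integral_one_sub_rpow_smul_le {μ C : ℝ} (hμ : 0 < μ) {f : ℝ → Y}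
    (hC : ∀ σ, ‖f σ‖ ≤ C) :
    ‖∫ σ in (0 : ℝ)..1, (1 - σ) ^ (μ - 1) • f σ‖ ≤ C / μ := by
  have h := intervalIntegral.norm_integral_le_of_norm_le (μ := volume) (zero_le_one (α := ℝ))
    (f := fun σ => (1 - σ) ^ (μ - 1) • f σ) (g := fun σ => (1 - σ) ^ (μ - 1) * C)
    (ae_of_all _ fun σ hσ => ?_) ((intervalIntegrable_one_sub_rpow hμ).mul_const C)
  · rw [intervalIntegral.integral_mul_const, integral_one_sub_rpow hμ] at h
    exact h.trans_eq (by ring)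
  · have : 0 ≤ 1 - σ := sub_nonneg.2 hσ.2
    rw [norm_smul, Real.norm_of_nonneg (by positivity)]
    gcongr
    exact hC σ

theorem continuous_integral_one_sub_rpow_smul {μ C : ℝ} (hμ : 0 < μ) {f : ℝ → Y}
    (hf : Continuous f) (hC : ∀ σ, ‖f σ‖ ≤ C) :
    Continuous fun t : ℝ => ∫ σ in (0 : ℝ)..1, (1 - σ) ^ (μ - 1) • f (t * σ) := by
  refine intervalIntegral.continuous_of_dominated_interval
    (bound := fun σ => (1 - σ) ^ (μ - 1) * C) (fun t => ?_) (fun t => ae_of_all _ fun σ hσ => ?_)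
    ((intervalIntegrable_one_sub_rpow hμ).mul_const C) (ae_of_all _ fun σ hσ => by fun_prop)
  · exact (intervalIntegrable_one_sub_rpow_smul hμ (f := fun σ => f (t * σ))
      (by fun_prop)).aestronglyMeasurable_restrict_uIoc
  · rw [uIoc_of_le zero_le_one] at hσ
    have : 0 ≤ 1 - σ := sub_nonneg.2 hσ.2
    rw [norm_smul, Real.norm_of_nonneg (by positivity)]
    gcongr
    exact hC _

/-- The substitution `s = tσ` frees the singular kernel and the domain from `t`, so that continuity
in `t` follows by dominated convergence. -/
theorem fracIntegral_eq_integral_one_sub {μ t : ℝ} (hμ : 0 < μ) (ht : 0 ≤ t) (f : ℝ → Y) :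
    fracIntegral μ f t =
      (t ^ μ / Real.Gamma μ) • ∫ σ in (0 : ℝ)..1, (1 - σ) ^ (μ - 1) • f (t * σ) := by
  rw [fracIntegral, if_neg hμ.ne']
  rcases ht.eq_or_lt with rfl | ht
  · simp [Real.zero_rpow hμ.ne']
  have h := intervalIntegral.smul_integral_comp_mul_left (a := 0) (b := 1)
    (fun s : ℝ => (t - s) ^ (μ - 1) • f s) t
  rw [mul_zero, mul_one] at h
  rw [← h]
  have h2 : ∫ σ in (0 : ℝ)..1, (t - t * σ) ^ (μ - 1) • f (t * σ) =
      t ^ (μ - 1) • ∫ σ in (0 : ℝ)..1, (1 - σ) ^ (μ - 1) • f (t * σ) := by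
    rw [← intervalIntegral.integral_smul]
    refine intervalIntegral.integral_congr fun σ hσ => ?_
    rw [uIcc_of_le zero_le_one] at hσ
    rw [← mul_one_sub, Real.mul_rpow ht.le (sub_nonneg.2 hσ.2), mul_smul]
  rw [h2, smul_smul, smul_smul, Real.rpow_sub_one ht.ne']
  congr 1
  field_simp

theorem fracIntegral_congr {μ t : ℝ} (ht : 0 ≤ t) {f g : ℝ → Y} (h : EqOn f g (Icc 0 t)) :
    fracIntegral μ f t = fracIntegral μ g t := by
  rw [fracIntegral, fracIntegral]
  split_ifs
  · exact h ⟨ht, le_rfl⟩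
  · congr 1
    refine intervalIntegral.integral_congr fun s hs => ?_
    rw [uIcc_of_le ht] at hs
    simp only [h hs]

variable {T : ℝ}

/-- The operator of fractional integration of order `μ > 0` on `C([0, T], Y)`;
the identity for `μ ≤ 0`. -/
def rlIntegral (hT : 0 ≤ T) (μ : ℝ) : C(Icc 0 T, Y) →L[ℝ] C(Icc 0 T, Y) :=
  if hμ : 0 < μ then
    LinearMap.mkContinuous
      { toFun := fun f =>
          ⟨fun t => ((t : ℝ) ^ μ / Real.Gamma μ) •
            ∫ σ in (0 : ℝ)..1, (1 - σ) ^ (μ - 1) • IccExtend hT f (t * σ), by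
            have := (continuous_integral_one_sub_rpow_smul hμ (f := IccExtend hT f)
              (f.continuous.Icc_extend') (fun σ => f.norm_coe_le_norm _)).comp
                (continuous_subtype_val (p := fun x => x ∈ Icc 0 T))
            refine Continuous.smul ?_ this
            exact (continuous_subtype_val.rpow_const fun _ => Or.inr hμ.le).div_const _⟩
        map_add' := fun f g => by
          ext t
          simp only [ContinuousMap.coe_mk, ContinuousMap.add_apply]
          rw [← smul_add, ← intervalIntegral.integral_add]
          · simp only [← smul_add]; rfl
          · exact intervalIntegrable_one_sub_rpow_smul hμ
              (f.continuous.Icc_extend'.comp (continuous_const_mul (t : ℝ)))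
          · exact intervalIntegrable_one_sub_rpow_smul hμ
              (g.continuous.Icc_extend'.comp (continuous_const_mul (t : ℝ)))
        map_smul' := fun c f => by
          ext t
          change ((t : ℝ) ^ μ / Real.Gamma μ) • _ = c • (((t : ℝ) ^ μ / Real.Gamma μ) •
            ∫ σ in (0 : ℝ)..1, (1 - σ) ^ (μ - 1) • IccExtend hT f (t * σ))
          rw [smul_comm c, ← intervalIntegral.integral_smul c]
          exact congrArg _ (intervalIntegral.integral_congr fun σ _ =>
            smul_comm ((1 - σ) ^ (μ - 1)) c (IccExtend hT f (t * σ))) }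
      (T ^ μ / Real.Gamma (μ + 1)) (fun f => by
        have hΓ := Real.Gamma_pos_of_pos hμ
        refine (ContinuousMap.norm_le _ ?_).2 fun t => ?_
        · have := Real.Gamma_pos_of_pos (by linarith : 0 < μ + 1)
          positivity
        have h0 : (0 : ℝ) ≤ t := t.2.1
        have h1 : (t : ℝ) ≤ T := t.2.2
        simp only [LinearMap.coe_mk, AddHom.coe_mk, ContinuousMap.coe_mk]
        rw [norm_smul, Real.norm_of_nonneg (by positivity), Real.Gamma_add_one hμ.ne']
        calc _ ≤ (T ^ μ / Real.Gamma μ) * (‖f‖ / μ) := by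
              gcongr
              exact norm_integral_one_sub_rpow_smul_le hμ fun σ => f.norm_coe_le_norm _
          _ = _ := by ring)
  else ContinuousLinearMap.id ℝ _

theorem rlIntegral_of_nonpos (hT : 0 ≤ T) {μ : ℝ} (hμ : μ ≤ 0) :
    (rlIntegral hT μ : C(Icc 0 T, Y) →L[ℝ] C(Icc 0 T, Y)) = 1 := by
  rw [rlIntegral, dif_neg hμ.not_gt]; rfl

theorem rlIntegral_zero (hT : 0 ≤ T) :
    (rlIntegral hT 0 : C(Icc 0 T, Y) →L[ℝ] C(Icc 0 T, Y)) = 1 :=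
  rlIntegral_of_nonpos hT le_rfl

theorem rlIntegral_apply (hT : 0 ≤ T) {μ : ℝ} (hμ : 0 < μ) (f : C(Icc 0 T, Y)) (t : Icc 0 T) :
    rlIntegral hT μ f t = ((t : ℝ) ^ μ / Real.Gamma μ) •
      ∫ σ in (0 : ℝ)..1, (1 - σ) ^ (μ - 1) • IccExtend hT f (t * σ) := by
  rw [rlIntegral, dif_pos hμ]; rfl

theorem fracIntegral_eq_rlIntegral (hT : 0 ≤ T) {μ t : ℝ} (hμ : 0 ≤ μ) (ht : t ∈ Icc 0 T)
    {x : ℝ → Y} {f : C(Icc 0 T, Y)} (h : ∀ s : Icc 0 T, x s = f s) :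
    fracIntegral μ x t = rlIntegral hT μ f ⟨t, ht⟩ := by
  rcases hμ.eq_or_lt with rfl | hμ
  · rw [rlIntegral_zero, fracIntegral, if_pos rfl]
    exact h ⟨t, ht⟩
  · have : EqOn x (IccExtend hT f) (Icc 0 t) := fun s hs => by
      have hs' : s ∈ Icc 0 T := ⟨hs.1, hs.2.trans ht.2⟩
      rw [IccExtend_of_mem hT f hs', ← h ⟨s, hs'⟩]
    rw [fracIntegral_congr ht.1 this, rlIntegral_apply hT hμ,
      fracIntegral_eq_integral_one_sub hμ ht.1]

theorem norm_rlIntegral_le (hT : 0 ≤ T) {μ : ℝ} (hμ : 0 ≤ μ) :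
    ‖(rlIntegral hT μ : C(Icc 0 T, Y) →L[ℝ] C(Icc 0 T, Y))‖ ≤ T ^ μ / Real.Gamma (μ + 1) := by
  rcases hμ.eq_or_lt with rfl | hμ
  · rw [rlIntegral_zero]
    simpa using! ContinuousLinearMap.norm_id_le (𝕜 := ℝ) (E := C(Icc 0 T, Y))
  · rw [rlIntegral, dif_pos hμ]
    have := Real.Gamma_pos_of_pos (by linarith : 0 < μ + 1)
    exact LinearMap.mkContinuous_norm_le _ (by positivity) _

theorem rlIntegral_compLeft [CompleteSpace Y] {Z : Type*} [NormedAddCommGroup Z] [NormedSpace ℝ Z]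
    [CompleteSpace Z]
    (hT : 0 ≤ T) (μ : ℝ) (L : Y →L[ℝ] Z) (f : C(Icc 0 T, Y)) :
    rlIntegral hT μ (L.compLeftContinuous ℝ (Icc 0 T) f) =
      L.compLeftContinuous ℝ (Icc 0 T) (rlIntegral hT μ f) := by
  rcases le_or_gt μ 0 with hμ | hμ
  · rw [rlIntegral_of_nonpos hT hμ, rlIntegral_of_nonpos hT hμ]; rfl
  · ext t
    have h : (L.compLeftContinuous ℝ (Icc 0 T) (rlIntegral hT μ f)) t = L (rlIntegral hT μ f t) := rfl
    rw [h, rlIntegral_apply hT hμ, rlIntegral_apply hT hμ, map_smul,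
      ← L.intervalIntegral_comp_comm (intervalIntegrable_one_sub_rpow_smul hμ
        (f := fun σ => IccExtend hT f (t * σ))
        (f.continuous.Icc_extend'.comp (continuous_const_mul (t : ℝ))))]
    simp only [map_smul]
    rfl

/-- The continuous function `t ↦ t ^ s` on `[0, T]`, for `s ≥ 0`. -/
def rpowMap (T : ℝ) (s : ℝ) (hs : 0 ≤ s) : C(Icc 0 T, ℝ) :=
  ⟨fun t => (t : ℝ) ^ s, continuous_subtype_val.rpow_const fun _ => Or.inr hs⟩

/-- Euler's Beta integral `B(s+1, μ)`, transferred from the complex version. -/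
theorem integral_one_sub_rpow_mul_rpow {μ s : ℝ} (hμ : 0 < μ) (hs : 0 ≤ s) :
    ∫ σ in (0 : ℝ)..1, (1 - σ) ^ (μ - 1) * σ ^ s =
      Real.Gamma μ * Real.Gamma (s + 1) / Real.Gamma (s + μ + 1) := by
  have hs1 : 0 < s + 1 := by linarith
  have h := Complex.betaIntegral_eq_Gamma_mul_div ((s + 1 : ℝ) : ℂ) (μ : ℂ)
    (by simpa using hs1) (by simpa using hμ)
  rw [← Complex.ofReal_add, Complex.Gamma_ofReal, Complex.Gamma_ofReal, Complex.Gamma_ofReal,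
    Complex.betaIntegral] at h
  have h2 : ∫ x : ℝ in (0 : ℝ)..1, (x : ℂ) ^ (((s + 1 : ℝ) : ℂ) - 1) *
      (1 - (x : ℂ)) ^ ((μ : ℂ) - 1) =
      ((∫ σ in (0 : ℝ)..1, (1 - σ) ^ (μ - 1) * σ ^ s : ℝ) : ℂ) := by
    rw [← intervalIntegral.integral_ofReal]
    refine intervalIntegral.integral_congr fun σ hσ => ?_
    rw [uIcc_of_le zero_le_one] at hσ
    rw [Complex.ofReal_mul, Complex.ofReal_cpow (sub_nonneg.2 hσ.2), Complex.ofReal_cpow hσ.1]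
    push_cast
    rw [add_sub_cancel_right, mul_comm]
  rw [h2] at h
  have h3 : s + 1 + μ = s + μ + 1 := by ring
  rw [h3] at h
  rw [mul_comm (Real.Gamma μ)]
  exact_mod_cast h

theorem rlIntegral_rpowMap (hT : 0 ≤ T) {μ s : ℝ} (hμ : 0 ≤ μ) (hs : 0 ≤ s) :
    rlIntegral hT μ (rpowMap T s hs) =
      (Real.Gamma (s + 1) / Real.Gamma (s + μ + 1)) • rpowMap T (s + μ) (by positivity) := by
  rcases hμ.eq_or_lt with rfl | hμ
  · rw [rlIntegral_zero]
    simp only [add_zero]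
    rw [div_self (Real.Gamma_pos_of_pos (by linarith)).ne', one_smul]; rfl
  · ext t
    rw [rlIntegral_apply hT hμ]
    have h0 : (0 : ℝ) ≤ t := t.2.1
    have : ∫ σ in (0 : ℝ)..1, (1 - σ) ^ (μ - 1) • IccExtend hT (rpowMap T s hs) (t * σ) =
        (t : ℝ) ^ s * ∫ σ in (0 : ℝ)..1, (1 - σ) ^ (μ - 1) * σ ^ s := by
      rw [← intervalIntegral.integral_const_mul]
      refine intervalIntegral.integral_congr fun σ hσ => ?_
      rw [uIcc_of_le zero_le_one] at hσ
      have hm : (t : ℝ) * σ ∈ Icc 0 T :=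
        ⟨mul_nonneg h0 hσ.1, (mul_le_of_le_one_right h0 hσ.2).trans t.2.2⟩
      rw [IccExtend_of_mem hT _ hm]
      simp only [rpowMap, ContinuousMap.coe_mk, smul_eq_mul]
      rw [Real.mul_rpow h0 hσ.1]; ring
    rw [this, integral_one_sub_rpow_mul_rpow hμ hs]
    simp only [rpowMap, ContinuousMap.coe_mk, smul_eq_mul, ContinuousMap.smul_apply]
    rw [add_comm s μ, Real.rpow_add_of_nonneg h0 hμ.le hs]
    have := (Real.Gamma_pos_of_pos hμ).ne'
    field_simp

/-- Both sides are continuous in `f`, so by Weierstrass monomials suffice; there the Gamma quotients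
telescope. No interchange of singular integrals is needed. -/
theorem rlIntegral_rlIntegral_real (hT : 0 ≤ T) {μ ν : ℝ} (hμ : 0 ≤ μ) (hν : 0 ≤ ν)
    (f : C(Icc 0 T, ℝ)) :
    rlIntegral hT μ (rlIntegral hT ν f) = rlIntegral hT (μ + ν) f := by
  have hcl : IsClosed {f : C(Icc 0 T, ℝ) |
      rlIntegral hT μ (rlIntegral hT ν f) = rlIntegral hT (μ + ν) f} :=
    isClosed_eq (by fun_prop) (by fun_prop)
  have hmem : f ∈ (polynomialFunctions (Icc 0 T)).topologicalClosure := by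
    rw [polynomialFunctions_closure_eq_top]; trivial
  refine closure_minimal ?_ hcl hmem
  rintro _ ⟨p, -, rfl⟩
  induction p using Polynomial.induction_on' with
  | add p q hp hq =>
    simp only [mem_ofPred_eq, map_add] at *
    rw [hp, hq]
  | monomial n a =>
    have : (Polynomial.toContinuousMapOnAlgHom (Icc 0 T)) (Polynomial.monomial n a) =
        a • rpowMap T n n.cast_nonneg := by
      ext t
      simp [rpowMap]
    simp only [mem_ofPred_eq, RingHom.coe_coe, this]
    rw [map_smul, map_smul, map_smul, rlIntegral_rpowMap hT hν,
      rlIntegral_rpowMap hT (add_nonneg hμ hν), map_smul, rlIntegral_rpowMap hT hμ, smul_smul]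
    have h1 : (n : ℝ) + (μ + ν) = n + ν + μ := by ring
    have h2 := (Real.Gamma_pos_of_pos (by positivity : 0 < (n : ℝ) + ν + 1)).ne'
    simp only [h1, smul_smul]
    congr 1
    field_simp

/-- Continuous functionals commute with the integrals and separate points, which reduces this to the
scalar case. -/
theorem rlIntegral_rlIntegral [CompleteSpace Y] (hT : 0 ≤ T) {μ ν : ℝ} (hμ : 0 ≤ μ) (hν : 0 ≤ ν)
    (f : C(Icc 0 T, Y)) :
    rlIntegral hT μ (rlIntegral hT ν f) = rlIntegral hT (μ + ν) f := by
  ext t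
  refine (SeparatingDual.eq_iff_forall_dual_eq (R := ℝ)).2 fun φ => ?_
  have h (κ : ℝ) (g : C(Icc 0 T, Y)) : φ (rlIntegral hT κ g t) =
      rlIntegral hT κ (φ.compLeftContinuous ℝ (Icc 0 T) g) t := by
    rw [rlIntegral_compLeft]; rfl
  rw [h, h, ← rlIntegral_rlIntegral_real hT hμ hν, rlIntegral_compLeft hT ν]

theorem rlIntegral_const [CompleteSpace Y] (hT : 0 ≤ T) {μ : ℝ} (hμ : 0 ≤ μ) (y : Y)
    (t : Icc 0 T) :
    rlIntegral hT μ (ContinuousMap.const _ y) t = ((t : ℝ) ^ μ / Real.Gamma (μ + 1)) • y := by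
  have h : ContinuousMap.const (Icc 0 T) y =
      (ContinuousLinearMap.toSpanSingleton ℝ y).compLeftContinuous ℝ (Icc 0 T)
        (rpowMap T 0 le_rfl) := by
    ext t; simp [rpowMap]
  rw [h, rlIntegral_compLeft, rlIntegral_rpowMap hT hμ]
  simp only [zero_add, Real.Gamma_one]
  simp [rpowMap, smul_smul, div_eq_inv_mul]

end FracEvol
end

/-! ### Neumann series for two commuting operators and the resolvent of the Volterra equation. -/

noncomputable section

namespace FracEvol

section Neumann

variable {R : Type*} [NormedRing R] [NormedAlgebra ℝ R]

/-- Summing the double series along antidiagonals gives the binomial theorem. Summability of the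
double series replaces the usual condition `‖P + Q‖ < 1`. -/
theorem hasSum_add_pow_of_commute {P Q : R} (hPQ : Commute P Q)
    (h : Summable fun p : ℕ × ℕ => ((p.1 + p.2).choose p.2 : ℝ) • (P ^ p.1 * Q ^ p.2)) :
    HasSum (fun n : ℕ => (P + Q) ^ n)
      (∑' p : ℕ × ℕ, ((p.1 + p.2).choose p.2 : ℝ) • (P ^ p.1 * Q ^ p.2)) := by
  have h1 := (Equiv.hasSum_iff Finset.HasAntidiagonal.sigmaAntidiagonalEquivProd).2 h.hasSum
  refine h1.sigma fun n => ?_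
  rw [hPQ.add_pow']
  have h2 := hasSum_fintype (fun c : Finset.HasAntidiagonal.antidiagonal n =>
    ((fun p : ℕ × ℕ => ((p.1 + p.2).choose p.2 : ℝ) • (P ^ p.1 * Q ^ p.2)) ∘
      Finset.HasAntidiagonal.sigmaAntidiagonalEquivProd) ⟨n, c⟩)
  convert h2 using 1
  rw [← Finset.sum_coe_sort]
  refine Finset.sum_congr rfl fun c _ => ?_
  have hc : c.1.1 + c.1.2 = n := Finset.HasAntidiagonal.mem_antidiagonal.1 c.2
  simp only [Function.comp_apply, Finset.HasAntidiagonal.sigmaAntidiagonalEquivProd_apply]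
  rw [Nat.cast_smul_eq_nsmul, ← Nat.choose_symm_add, hc]

theorem one_sub_add_mul_tsum_of_commute {P Q : R} (hPQ : Commute P Q)
    (h : Summable fun p : ℕ × ℕ => ((p.1 + p.2).choose p.2 : ℝ) • (P ^ p.1 * Q ^ p.2)) :
    (1 - (P + Q)) * (∑' p : ℕ × ℕ, ((p.1 + p.2).choose p.2 : ℝ) • (P ^ p.1 * Q ^ p.2)) = 1 := by
  have := hasSum_add_pow_of_commute hPQ h
  rw [← this.tsum_eq, this.summable.one_sub_mul_tsum_pow]

theorem tsum_mul_one_sub_add_of_commute {P Q : R} (hPQ : Commute P Q)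
    (h : Summable fun p : ℕ × ℕ => ((p.1 + p.2).choose p.2 : ℝ) • (P ^ p.1 * Q ^ p.2)) :
    (∑' p : ℕ × ℕ, ((p.1 + p.2).choose p.2 : ℝ) • (P ^ p.1 * Q ^ p.2)) * (1 - (P + Q)) = 1 := by
  have := hasSum_add_pow_of_commute hPQ h
  rw [← this.tsum_eq, this.summable.tsum_pow_mul_one_sub]

variable {E : Type*} [NormedAddCommGroup E] [NormedSpace ℝ E]

theorem summable_choose_smul_pow_mul_pow [CompleteSpace E] {P Q : E →L[ℝ] E} {b : ℕ × ℕ → ℝ}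
    (hb : Summable fun p : ℕ × ℕ => ((p.1 + p.2).choose p.2 : ℝ) * b p)
    (h : ∀ p, ‖P ^ p.1 * Q ^ p.2‖ ≤ b p) :
    Summable fun p : ℕ × ℕ => ((p.1 + p.2).choose p.2 : ℝ) • (P ^ p.1 * Q ^ p.2) := by
  refine Summable.of_norm_bounded hb fun p => ?_
  rw [norm_smul, Real.norm_of_nonneg (by positivity)]
  gcongr
  exact h p

theorem eq_add_iff_eq_tsum_apply [CompleteSpace E] {P Q : E →L[ℝ] E} (hPQ : Commute P Q)
    (hs : Summable fun p : ℕ × ℕ => ((p.1 + p.2).choose p.2 : ℝ) • (P ^ p.1 * Q ^ p.2))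
    (u f : E) : u = f + (P u + Q u) ↔
      u = (∑' p : ℕ × ℕ, ((p.1 + p.2).choose p.2 : ℝ) • (P ^ p.1 * Q ^ p.2)) f := by
  have h1 := one_sub_add_mul_tsum_of_commute hPQ hs
  have h2 := tsum_mul_one_sub_add_of_commute hPQ hs
  -- The left inverse gives uniqueness, the right inverse existence.
  constructor
  · intro h
    have h3 : (1 - (P + Q)) u = f := sub_eq_of_eq_add h
    have h4 := congrArg (fun L : E →L[ℝ] E => L u) h2
    rw [← h3]
    exact h4.symm
  · rintro h
    have h4 := congrArg (fun L : E →L[ℝ] E => L f) h1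
    simp only [mul_apply_eq_comp, ← h] at h4
    exact sub_eq_iff_eq_add.1 h4

theorem norm_mul_le_of_le_of_le {P Q : E →L[ℝ] E} {a b : ℝ} (hP : ‖P‖ ≤ a) (hQ : ‖Q‖ ≤ b) :
    ‖P * Q‖ ≤ a * b :=
  (norm_mul_le _ _).trans (mul_le_mul hP hQ (norm_nonneg _) ((norm_nonneg _).trans hP))

end Neumann

variable {Y : Type*} [NormedAddCommGroup Y] [NormedSpace ℝ Y] {T : ℝ}

theorem norm_compLeftContinuous_le (L : Y →L[ℝ] Y) :
    ‖L.compLeftContinuous ℝ (Icc 0 T)‖ ≤ ‖L‖ := by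
  refine ContinuousLinearMap.opNorm_le_bound _ (norm_nonneg _) fun f => ?_
  refine (ContinuousMap.norm_le _ (by positivity)).2 fun t => ?_
  exact (L.le_opNorm _).trans (by gcongr; exact f.norm_coe_le_norm t)

/-- The operator `x ↦ L (I^μ x)` on `C([0, T], Y)`. -/
def rlIntegralComp (hT : 0 ≤ T) (L : Y →L[ℝ] Y) (μ : ℝ) : C(Icc 0 T, Y) →L[ℝ] C(Icc 0 T, Y) :=
  L.compLeftContinuous ℝ (Icc 0 T) * rlIntegral hT μ

theorem rlIntegralComp_apply (hT : 0 ≤ T) (L : Y →L[ℝ] Y) (μ : ℝ) (f : C(Icc 0 T, Y))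
    (t : Icc 0 T) : rlIntegralComp hT L μ f t = L (rlIntegral hT μ f t) := rfl

theorem norm_rlIntegralComp_le (hT : 0 ≤ T) (L : Y →L[ℝ] Y) {μ : ℝ} (hμ : 0 ≤ μ) :
    ‖rlIntegralComp hT L μ‖ ≤ ‖L‖ * (T ^ μ / Real.Gamma (μ + 1)) :=
  norm_mul_le_of_le_of_le (norm_compLeftContinuous_le L) (norm_rlIntegral_le hT hμ)

theorem rlIntegralComp_one_zero (hT : 0 ≤ T) :
    rlIntegralComp hT (1 : Y →L[ℝ] Y) 0 = 1 := by
  rw [rlIntegralComp, rlIntegral_zero]; rfl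

theorem continuousOn_permTerm_apply (A B : Y →L[ℝ] Y) {α β δ : ℝ} (hβ : 0 ≤ β) (hβα : β < α)
    (hδ : 0 ≤ δ) (t : ℝ) (k m : ℕ) {f : ℝ → Y} {s : Set ℝ} (hf : ContinuousOn f s) :
    ContinuousOn (fun s => permTerm A B α β δ (t - s) k m (f s)) s := by
  have hγ := sub_pos.2 hβα
  have hα := hβ.trans_lt hβα
  have h : Continuous fun s : ℝ => (t - s) ^ ((k : ℝ) * (α - β) + (m : ℝ) * α + δ) :=
    (continuous_const.sub continuous_id).rpow_const fun _ => Or.inr (by positivity)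
  simp only [permTerm, smul_apply]
  exact (((h.div_const _).const_mul _).continuousOn).smul
    ((A ^ k * B ^ m).continuous.comp_continuousOn hf)

theorem norm_permTerm_apply_le (A B : Y →L[ℝ] Y) {α β δ t s : ℝ} (hβ : 0 ≤ β) (hβα : β < α)
    (hδ : 0 ≤ δ) (hs : s ∈ Icc 0 t) (k m : ℕ) {y : Y} {C : ℝ} (hy : ‖y‖ ≤ C) :
    ‖permTerm A B α β δ (t - s) k m y‖ ≤ ((k + m).choose m : ℝ) *
      (t ^ ((k : ℝ) * (α - β) + (m : ℝ) * α + δ) /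
        Real.Gamma ((k : ℝ) * (α - β) + (m : ℝ) * α + δ + 1)) * (‖A‖ ^ k * ‖B‖ ^ m) * C := by
  have hγ := sub_pos.2 hβα
  have hα := hβ.trans_lt hβα
  have hts : 0 ≤ t - s := sub_nonneg.2 hs.2
  have ht : 0 ≤ t := hs.1.trans hs.2
  have hG := Real.Gamma_pos_of_pos
    (by positivity : 0 < (k : ℝ) * (α - β) + (m : ℝ) * α + δ + 1)
  refine ((permTerm A B α β δ (t - s) k m).le_opNorm y).trans ?_
  refine mul_le_mul ?_ hy (norm_nonneg _) (by positivity)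
  refine (norm_permTerm_le A B hα.le hβα.le hδ hts k m).trans ?_
  gcongr
  linarith [hs.1]

variable [CompleteSpace Y]

theorem rlIntegralComp_mul (hT : 0 ≤ T) (L M : Y →L[ℝ] Y) {μ ν : ℝ} (hμ : 0 ≤ μ) (hν : 0 ≤ ν) :
    rlIntegralComp hT L μ * rlIntegralComp hT M ν = rlIntegralComp hT (L * M) (μ + ν) := by
  refine ContinuousLinearMap.ext fun f => ?_
  ext t
  have h : (rlIntegralComp hT L μ * rlIntegralComp hT M ν) f =
    L.compLeftContinuous ℝ (Icc 0 T) (rlIntegral hT μ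
      (M.compLeftContinuous ℝ (Icc 0 T) (rlIntegral hT ν f))) := rfl
  rw [h, rlIntegral_compLeft, rlIntegral_rlIntegral hT hμ hν]
  rfl

theorem rlIntegralComp_pow (hT : 0 ≤ T) (L : Y →L[ℝ] Y) {μ : ℝ} (hμ : 0 ≤ μ) (n : ℕ) :
    rlIntegralComp hT L μ ^ n = rlIntegralComp hT (L ^ n) (n * μ) := by
  induction n with
  | zero => simp [rlIntegralComp_one_zero]
  | succ n ih =>
    rw [pow_succ, ih, rlIntegralComp_mul hT _ _ (by positivity) hμ, ← pow_succ]
    congr 1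
    push_cast; ring

theorem rlIntegralComp_pow_mul_pow (hT : 0 ≤ T) (A B : Y →L[ℝ] Y) {μ ν : ℝ} (hμ : 0 ≤ μ)
    (hν : 0 ≤ ν) (k m : ℕ) : rlIntegralComp hT A μ ^ k * rlIntegralComp hT B ν ^ m =
      rlIntegralComp hT (A ^ k * B ^ m) (k * μ + m * ν) := by
  rw [rlIntegralComp_pow hT A hμ, rlIntegralComp_pow hT B hν,
    rlIntegralComp_mul hT _ _ (by positivity) (by positivity)]

theorem commute_rlIntegralComp (hT : 0 ≤ T) {A B : Y →L[ℝ] Y} (hAB : Commute A B) {μ ν : ℝ}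
    (hμ : 0 ≤ μ) (hν : 0 ≤ ν) : Commute (rlIntegralComp hT A μ) (rlIntegralComp hT B ν) := by
  rw [commute_iff_eq, rlIntegralComp_mul hT _ _ hμ hν, rlIntegralComp_mul hT _ _ hν hμ, hAB.eq,
    add_comm]

/-- The powers must be merged into one fractional integral before taking norms: its Gamma factor
gives convergence for every `T`. -/
theorem summable_choose_smul_rlIntegralComp (hT : 0 ≤ T) (A B : Y →L[ℝ] Y) {γ ρ : ℝ}
    (hγ : 0 < γ) (hγρ : γ ≤ ρ) :
    Summable fun p : ℕ × ℕ => ((p.1 + p.2).choose p.2 : ℝ) •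
      (rlIntegralComp hT A γ ^ p.1 * rlIntegralComp hT B ρ ^ p.2) := by
  have hρ := hγ.trans_le hγρ
  refine summable_choose_smul_pow_mul_pow (b := fun p => T ^ (p.1 * γ + p.2 * ρ) /
    Real.Gamma (p.1 * γ + p.2 * ρ + 1) * (‖A‖ ^ p.1 * ‖B‖ ^ p.2)) ?_ fun p => ?_
  · refine (summable_choose_mul_rpow_div_Gamma (norm_nonneg A) (norm_nonneg B) hγ hγρ le_rfl
      hT).congr fun p => ?_
    rw [mul_assoc, add_zero]
  · rw [rlIntegralComp_pow_mul_pow hT _ _ hγ.le hρ.le]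
    refine (norm_rlIntegralComp_le hT _ (by positivity)).trans ?_
    rw [mul_comm]
    have := Real.Gamma_pos_of_pos (by positivity : 0 < (p.1 : ℝ) * γ + p.2 * ρ + 1)
    gcongr
    exact norm_pow_mul_pow_le A B _ _

/-- The resolvent `∑ C(k+m, m) (A I^γ)^k (B I^ρ)^m` of the operator `A I^γ + B I^ρ`. -/
def resolventSeries (hT : 0 ≤ T) (A B : Y →L[ℝ] Y) (γ ρ : ℝ) :
    C(Icc 0 T, Y) →L[ℝ] C(Icc 0 T, Y) :=
  ∑' p : ℕ × ℕ, ((p.1 + p.2).choose p.2 : ℝ) •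
    (rlIntegralComp hT A γ ^ p.1 * rlIntegralComp hT B ρ ^ p.2)

theorem eq_resolventSeries_apply_iff (hT : 0 ≤ T) {A B : Y →L[ℝ] Y} (hAB : Commute A B) {γ ρ : ℝ}
    (hγ : 0 < γ) (hγρ : γ ≤ ρ) (u f : C(Icc 0 T, Y)) :
    u = f + (rlIntegralComp hT A γ u + rlIntegralComp hT B ρ u) ↔
      u = resolventSeries hT A B γ ρ f :=
  eq_add_iff_eq_tsum_apply (commute_rlIntegralComp hT hAB hγ.le (hγ.le.trans hγρ))
    (summable_choose_smul_rlIntegralComp hT A B hγ hγρ) u f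

theorem hasSum_resolventSeries_apply (hT : 0 ≤ T) (A B : Y →L[ℝ] Y) {γ ρ : ℝ}
    (hγ : 0 < γ) (hγρ : γ ≤ ρ) (f : C(Icc 0 T, Y)) (t : Icc 0 T) :
    HasSum (fun p : ℕ × ℕ => ((p.1 + p.2).choose p.2 : ℝ) •
      (A ^ p.1 * B ^ p.2) (rlIntegral hT (p.1 * γ + p.2 * ρ) f t))
      (resolventSeries hT A B γ ρ f t) := by
  have h := (summable_choose_smul_rlIntegralComp hT A B hγ hγρ).hasSum
  have h2 := h.mapL ((ContinuousMap.evalCLM ℝ t).comp (ContinuousLinearMap.apply ℝ _ f))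
  rw [← resolventSeries] at h2
  refine h2.congr_fun fun p => ?_
  rw [rlIntegralComp_pow_mul_pow hT _ _ hγ.le (hγ.le.trans hγρ)]
  rfl

theorem hasSum_permTerm (A B : Y →L[ℝ] Y) {α β δ t : ℝ} (hβ : 0 ≤ β) (hβα : β < α)
    (hδ : 0 ≤ δ) (ht : 0 ≤ t) :
    HasSum (fun p : ℕ × ℕ => permTerm A B α β δ t p.1 p.2) (permSeries A B α β δ t) := by
  have h := (summable_norm_permTerm A B hβ hβα hδ ht).of_norm
  rw [permSeries, ← h.tsum_prod]
  exact h.hasSum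

theorem resolventSeries_rlIntegral_const (hT : 0 ≤ T) (A B : Y →L[ℝ] Y) {α β δ : ℝ} (hβ : 0 ≤ β)
    (hβα : β < α) (hδ : 0 ≤ δ) (y : Y) (t : Icc 0 T) :
    resolventSeries hT A B (α - β) α (rlIntegral hT δ (ContinuousMap.const _ y)) t =
      permSeries A B α β δ t y := by
  refine (hasSum_resolventSeries_apply hT A B (sub_pos.2 hβα) (sub_le_self _ hβ) _ t).unique ?_
  have h := (hasSum_permTerm A B hβ hβα hδ t.2.1).mapL (ContinuousLinearMap.apply ℝ Y y)
  refine h.congr_fun fun p => ?_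
  have hγ := sub_pos.2 hβα
  have hα := hβ.trans_lt hβα
  rw [rlIntegral_rlIntegral hT (by positivity) hδ, rlIntegral_const hT (by positivity)]
  simp [permTerm, smul_smul]

theorem tsum_permTerm_mul (A B : Y →L[ℝ] Y) {α β δ t : ℝ} (hβ : 0 ≤ β) (hβα : β < α)
    (hδ : 0 ≤ δ) (ht : 0 ≤ t) :
    ∑' k : ℕ, ∑' m : ℕ, permTerm A B α β δ t k m * B = permSeries A B α β δ t * B := by
  have h := (hasSum_permTerm A B hβ hβα hδ ht).mul_right B
  rw [← h.tsum_eq, h.summable.tsum_prod]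

theorem continuousOn_permSeries_apply (A B : Y →L[ℝ] Y) {α β δ t : ℝ} (hβ : 0 ≤ β) (hβα : β < α)
    (hδ : 0 ≤ δ) (ht : 0 ≤ t) {f : ℝ → Y} (hf : ContinuousOn f (Icc 0 t)) :
    ContinuousOn (fun s => permSeries A B α β δ (t - s) (f s)) (Icc 0 t) := by
  obtain ⟨C, hC⟩ := isCompact_Icc.exists_bound_of_continuousOn hf
  have h := continuousOn_tsum (s := Icc 0 t)
    (f := fun (p : ℕ × ℕ) s => permTerm A B α β δ (t - s) p.1 p.2 (f s))
    (fun p => continuousOn_permTerm_apply A B hβ hβα hδ t p.1 p.2 hf)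
    ((summable_choose_mul_rpow_div_Gamma (norm_nonneg A) (norm_nonneg B) (sub_pos.2 hβα)
      (sub_le_self _ hβ) hδ ht).mul_right C)
    (fun p s hs => norm_permTerm_apply_le A B hβ hβα hδ hs p.1 p.2 (hC s hs))
  refine h.congr fun s hs => ?_
  have := (hasSum_permTerm A B hβ hβα hδ (sub_nonneg.2 hs.2)).mapL
    (ContinuousLinearMap.apply ℝ Y (f s))
  exact this.tsum_eq.symm

/-- Each term is a single fractional integral of order `kγ+mα+α`; sum and integral are exchanged by
dominated convergence. As `α ≥ 1`, all kernel exponents are nonnegative, so the majorant is the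
series at `t` itself. -/
theorem resolventSeries_rlIntegral (hT : 0 ≤ T) (A B : Y →L[ℝ] Y) {α β : ℝ} (hα : 1 ≤ α)
    (hβ : 0 ≤ β) (hβα : β < α) (f : C(Icc 0 T, Y)) {g : ℝ → Y} (hg : ∀ s : Icc 0 T, g s = f s)
    (t : Icc 0 T) :
    resolventSeries hT A B (α - β) α (rlIntegral hT α f) t =
      ∫ s in (0 : ℝ)..t, permSeries A B α β (α - 1) (t - s) (g s) := by
  have hδ : 0 ≤ α - 1 := sub_nonneg.2 hα
  have hα0 : 0 < α := by linarith
  have hγ := sub_pos.2 hβα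
  have ht : (0 : ℝ) ≤ t := t.2.1
  have hgc : ContinuousOn g (Icc 0 (t : ℝ)) := by
    refine ContinuousOn.mono ?_ (Icc_subset_Icc_right t.2.2)
    rw [continuousOn_iff_continuous_domRestrict]
    exact f.continuous.congr fun s => (hg s).symm
  obtain ⟨C, hC⟩ := isCompact_Icc.exists_bound_of_continuousOn hgc
  refine (hasSum_resolventSeries_apply hT A B hγ (sub_le_self _ hβ) _ t).unique ?_
  have hsub : uIoc 0 (t : ℝ) ⊆ Icc 0 (t : ℝ) := by
    rw [uIoc_of_le ht]; exact Ioc_subset_Icc_self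
  have h := intervalIntegral.hasSum_integral_of_dominated_convergence (μ := volume)
    (a := 0) (b := (t : ℝ))
    (F := fun (p : ℕ × ℕ) s => permTerm A B α β (α - 1) (t - s) p.1 p.2 (g s))
    (f := fun s => permSeries A B α β (α - 1) (t - s) (g s))
    (fun p _ => ((p.1 + p.2).choose p.2 : ℝ) *
      ((t : ℝ) ^ ((p.1 : ℝ) * (α - β) + (p.2 : ℝ) * α + (α - 1)) /
        Real.Gamma ((p.1 : ℝ) * (α - β) + (p.2 : ℝ) * α + (α - 1) + 1)) *
          (‖A‖ ^ p.1 * ‖B‖ ^ p.2) * C)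
    (fun p => ((continuousOn_permTerm_apply A B hβ hβα hδ t p.1 p.2 hgc).mono
      hsub).aestronglyMeasurable measurableSet_uIoc)
    (fun p => ae_of_all _ fun s hs =>
      norm_permTerm_apply_le A B hβ hβα hδ (hsub hs) p.1 p.2 (hC s (hsub hs)))
    (ae_of_all _ fun s _ => (summable_choose_mul_rpow_div_Gamma (norm_nonneg A) (norm_nonneg B)
      hγ (sub_le_self _ hβ) hδ ht).mul_right C)
    intervalIntegrable_const
    (ae_of_all _ fun s hs => (hasSum_permTerm A B hβ hβα hδ
      (sub_nonneg.2 (hsub hs).2)).mapL (ContinuousLinearMap.apply ℝ Y (g s)))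
  convert h using 1
  ext p
  have hσ : 0 < (p.1 : ℝ) * (α - β) + (p.2 : ℝ) * α + α := by positivity
  have hint : IntervalIntegrable (fun s : ℝ => ((t : ℝ) - s) ^
      ((p.1 : ℝ) * (α - β) + (p.2 : ℝ) * α + α - 1) • g s) volume 0 t := by
    have h2 : 0 ≤ (p.1 : ℝ) * (α - β) + (p.2 : ℝ) * α + α - 1 := by
      rw [add_sub_assoc]; positivity
    refine ContinuousOn.intervalIntegrable ?_
    rw [uIcc_of_le ht]
    exact (((continuous_const.sub continuous_id).rpow_const
      fun _ => Or.inr h2).continuousOn).smul hgc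
  rw [rlIntegral_rlIntegral hT (by positivity) hα0.le,
    ← fracIntegral_eq_rlIntegral hT hσ.le t.2 hg, fracIntegral, if_neg hσ.ne', map_smul,
    ← ContinuousLinearMap.intervalIntegral_comp_comm _ hint, smul_smul,
    ← intervalIntegral.integral_smul]
  refine intervalIntegral.integral_congr fun s _ => ?_
  simp only [permTerm, smul_apply, map_smul, smul_smul, ← add_sub_assoc,
    sub_add_cancel]
  congr 1
  ring

/-- The representation formula is the resolvent applied to the inhomogeneity of the Volterra
equation for `x - η`. -/
theorem permFormula_eq_add_resolventSeries (hT : 0 ≤ T) (A B : Y →L[ℝ] Y) {α β : ℝ} (hα : 1 ≤ α)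
    (hβ : 0 ≤ β) (hβα : β < α) (η η' : Y) (f : C(Icc 0 T, Y)) {g : ℝ → Y}
    (hg : ∀ s : Icc 0 T, g s = f s) (t : Icc 0 T) :
    permFormula A B α β η η' g t = η + resolventSeries hT A B (α - β) α
      (rlIntegral hT 1 (ContinuousMap.const _ η') +
        rlIntegral hT α (ContinuousMap.const _ (B η) + f)) t := by
  rw [permFormula, tsum_permTerm_mul A B hβ hβα (by linarith) t.2.1, map_add, map_add, map_add,
    ContinuousMap.add_apply, ContinuousMap.add_apply,
    resolventSeries_rlIntegral_const hT A B hβ hβα zero_le_one,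
    resolventSeries_rlIntegral_const hT A B hβ hβα (by linarith),
    resolventSeries_rlIntegral hT A B hα hβ hβα f hg]
  simp only [add_apply, one_apply_eq_self,
    mul_apply_eq_comp]
  abel

end FracEvol
end

/-! ### Caputo derivatives of `C¹` functions and regularity of Volterra solutions. -/

noncomputable section

namespace FracEvol

theorem exists_continuousMap_eq {E : Type*} [TopologicalSpace E] {T : ℝ} {x : ℝ → E} (hx : ContinuousOn x (Icc 0 T)) :
    ∃ X : C(Icc 0 T, E), ∀ s : Icc 0 T, x s = X s :=
  ⟨⟨(Icc 0 T).domRestrict x, continuousOn_iff_continuous_domRestrict.1 hx⟩, fun _ => rfl⟩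

variable {Y : Type*} [NormedAddCommGroup Y] [NormedSpace ℝ Y] {T : ℝ}

theorem rlIntegral_one_apply (hT : 0 ≤ T) (f : C(Icc 0 T, Y)) (t : Icc 0 T) :
    rlIntegral hT 1 f t = ∫ s in (0 : ℝ)..t, IccExtend hT f s := by
  rw [← fracIntegral_eq_rlIntegral hT zero_le_one t.2 (x := IccExtend hT f)
    (fun s => IccExtend_val hT f s), fracIntegral, if_neg one_ne_zero]
  simp

theorem rlIntegral_apply_zero (hT : 0 ≤ T) {μ : ℝ} (hμ : 0 < μ) (f : C(Icc 0 T, Y))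
    (h : (0 : ℝ) ∈ Icc 0 T) : rlIntegral hT μ f ⟨0, h⟩ = 0 := by
  rw [rlIntegral_apply hT hμ]
  simp [Real.zero_rpow hμ.ne']

/-- Needed for `I^(2-α)` at the endpoint `α = 2`, where it is the identity and does not vanish at 0
by itself. -/
theorem rlIntegral_apply_zero_of_apply_zero (hT : 0 ≤ T) {μ : ℝ} (hμ : 0 ≤ μ)
    (f : C(Icc 0 T, Y)) (h : (0 : ℝ) ∈ Icc 0 T) (hf : f ⟨0, h⟩ = 0) :
    rlIntegral hT μ f ⟨0, h⟩ = 0 := by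
  rcases hμ.eq_or_lt with rfl | hμ
  · rw [rlIntegral_zero]; exact hf
  · exact rlIntegral_apply_zero hT hμ f h

variable [CompleteSpace Y]

theorem hasDerivWithinAt_of_eq_add_rlIntegral_one (hT : 0 ≤ T) {x : ℝ → Y} {c : Y}
    {f : C(Icc 0 T, Y)} {S : Set ℝ} (hS : S ⊆ Icc 0 T)
    (h : ∀ (t : ℝ) (ht : t ∈ S), x t = c + rlIntegral hT 1 f ⟨t, hS ht⟩) {t : ℝ} (ht : t ∈ S) :
    HasDerivWithinAt x (f ⟨t, hS ht⟩) S t := by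
  have h1 : HasDerivAt (fun u => c + ∫ s in (0 : ℝ)..u, IccExtend hT f s)
      (f ⟨t, hS ht⟩) t := by
    have := (f.continuous.Icc_extend' (h := hT)).integral_hasStrictDerivAt 0 t
    rw [IccExtend_of_mem hT f (hS ht)] at this
    exact this.hasDerivAt.const_add c
  refine h1.hasDerivWithinAt.congr (fun s hs => ?_) ?_
  · rw [h s hs, rlIntegral_one_apply]
  · rw [h t ht, rlIntegral_one_apply]

theorem eq_add_rlIntegral_one_of_hasDerivWithinAt (hT : 0 ≤ T) {x : ℝ → Y} {f : C(Icc 0 T, Y)}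
    (hx : ContinuousOn x (Icc 0 T))
    (h : ∀ (t : ℝ) (ht : t ∈ Ioc 0 T),
      HasDerivWithinAt x (f ⟨t, Ioc_subset_Icc_self ht⟩) (Ioc 0 T) t) (t : Icc 0 T) :
    x t = x 0 + rlIntegral hT 1 f t := by
  have h1 := intervalIntegral.integral_eq_sub_of_hasDerivAt_of_le (f := x)
    (f' := IccExtend hT f) t.2.1 (hx.mono (Icc_subset_Icc_right t.2.2)) (fun s hs => ?_)
    ((f.continuous.Icc_extend' (h := hT)).intervalIntegrable _ _)
  · rw [rlIntegral_one_apply, h1]; abel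
  · have hs' : s ∈ Ioc 0 T := ⟨hs.1, hs.2.le.trans t.2.2⟩
    rw [IccExtend_of_mem hT f (Ioc_subset_Icc_self hs')]
    exact (h s hs').hasDerivAt (Ioc_mem_nhds hs.1 (hs.2.trans_le t.2.2))

theorem rlIntegral_one_injective (hT : 0 < T) :
    Function.Injective (rlIntegral hT.le 1 : C(Icc 0 T, Y) → C(Icc 0 T, Y)) := by
  intro f g hfg
  ext t
  refine (uniqueDiffOn_Icc hT t t.2).eq_deriv _
    (hasDerivWithinAt_of_eq_add_rlIntegral_one hT.le (c := 0)
      (x := IccExtend hT.le (rlIntegral hT.le 1 f)) Subset.rfl (fun s hs => ?_) t.2)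
    (hasDerivWithinAt_of_eq_add_rlIntegral_one hT.le (c := 0)
      (x := IccExtend hT.le (rlIntegral hT.le 1 f)) Subset.rfl (fun s hs => ?_) t.2)
  · rw [IccExtend_of_mem _ _ hs, zero_add]
  · rw [IccExtend_of_mem _ _ hs, zero_add, hfg]

theorem rlIntegral_comm (hT : 0 ≤ T) {μ ν : ℝ} (hμ : 0 ≤ μ) (hν : 0 ≤ ν) (f : C(Icc 0 T, Y)) :
    rlIntegral hT μ (rlIntegral hT ν f) = rlIntegral hT ν (rlIntegral hT μ f) := by
  rw [rlIntegral_rlIntegral hT hμ hν, rlIntegral_rlIntegral hT hν hμ, add_comm]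

theorem derivWithin_Icc_eq (hT : 0 < T) {x : ℝ → Y} {c : Y} {f : C(Icc 0 T, Y)}
    (h : ∀ t : Icc 0 T, x t = c + rlIntegral hT.le 1 f t) (t : Icc 0 T) :
    derivWithin x (Icc 0 T) t = f t :=
  (hasDerivWithinAt_of_eq_add_rlIntegral_one hT.le Subset.rfl (fun s hs => h ⟨s, hs⟩)
    t.2).derivWithin (uniqueDiffOn_Icc hT t t.2)

theorem contDiffOn_one_iff_exists_rlIntegral (hT : 0 < T) {x : ℝ → Y} :
    ContDiffOn ℝ 1 x (Icc 0 T) ↔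
      ∃ f : C(Icc 0 T, Y), ∀ t : Icc 0 T, x t = x 0 + rlIntegral hT.le 1 f t := by
  rw [contDiffOn_one_iff_derivWithin (uniqueDiffOn_Icc hT)]
  constructor
  · rintro ⟨hd, hc⟩
    obtain ⟨f, hf⟩ := exists_continuousMap_eq hc
    refine ⟨f, eq_add_rlIntegral_one_of_hasDerivWithinAt hT.le hd.continuousOn fun t ht => ?_⟩
    rw [← hf ⟨t, Ioc_subset_Icc_self ht⟩]
    exact (hd t (Ioc_subset_Icc_self ht)).hasDerivWithinAt.mono Ioc_subset_Icc_self
  · rintro ⟨f, hf⟩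
    refine ⟨fun t ht => (hasDerivWithinAt_of_eq_add_rlIntegral_one hT.le Subset.rfl
      (fun s hs => hf ⟨s, hs⟩) ht).differentiableWithinAt, ?_⟩
    rw [continuousOn_iff_continuous_domRestrict]
    exact f.continuous.congr fun t => (derivWithin_Icc_eq hT hf t).symm

/-- For `x ∈ C¹` and `0 < β ≤ 1` the Caputo derivative of order `β` is `I^(1-β) x'`. -/
theorem hasCaputoDeriv_iff_of_le_one (hT : 0 < T) {β : ℝ} (hβ₀ : 0 < β) (hβ₁ : β ≤ 1) {x : ℝ → Y}
    {f : C(Icc 0 T, Y)} (hf : ∀ t : Icc 0 T, x t = x 0 + rlIntegral hT.le 1 f t) (b : Y) {t : ℝ}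
    (ht : t ∈ Ioc 0 T) :
    HasCaputoDeriv T β x b t ↔ b = rlIntegral hT.le (1 - β) f ⟨t, Ioc_subset_Icc_self ht⟩ := by
  have hn : ⌈β⌉₊ = 1 := (Nat.ceil_eq_iff one_ne_zero).2 ⟨by simpa using hβ₀, by simpa using hβ₁⟩
  rw [HasCaputoDeriv, HasRLDeriv, hn]
  simp only [Finset.sum_range_one, iteratedDerivWithin_zero, tsub_self, Nat.cast_one, pow_zero,
    Nat.factorial_zero, div_one, one_smul]
  have hmain : HasDerivWithinAt (fracIntegral (1 - β) fun s => x s - x 0)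
      (rlIntegral hT.le (1 - β) f ⟨t, Ioc_subset_Icc_self ht⟩) (Ioc 0 T) t := by
    refine hasDerivWithinAt_of_eq_add_rlIntegral_one hT.le (c := 0) Ioc_subset_Icc_self
      (fun s hs => ?_) ht
    -- `I^(1-β) (x - x(0)) = I^(1-β) I^1 f = I^1 I^(1-β) f`, and the outer `I^1` can be
    -- differentiated away.
    rw [zero_add, rlIntegral_comm hT.le zero_le_one (sub_nonneg.2 hβ₁)]
    exact fracIntegral_eq_rlIntegral hT.le (sub_nonneg.2 hβ₁) (Ioc_subset_Icc_self hs)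
      fun r => by rw [hf r, add_sub_cancel_left]
  constructor
  · rintro ⟨-, h⟩
    exact (uniqueDiffOn_Ioc 0 T t ht).eq_deriv _ h hmain
  · rintro rfl
    exact ⟨fun i hi => by omega, hmain⟩

/-- For `x ∈ C¹` and `1 < α ≤ 2` the Caputo derivative of order `α` is the derivative of
`I^(2-α) (x' - x'(0))`. -/
theorem hasCaputoDeriv_iff_of_one_lt (hT : 0 < T) {α : ℝ} (hα₁ : 1 < α) (hα₂ : α ≤ 2) {x : ℝ → Y}
    {f : C(Icc 0 T, Y)} (hf : ∀ t : Icc 0 T, x t = x 0 + rlIntegral hT.le 1 f t) (a : Y) {t : ℝ}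
    (ht : t ∈ Ioc 0 T) :
    HasCaputoDeriv T α x a t ↔ HasDerivWithinAt (IccExtend hT.le (rlIntegral hT.le (2 - α)
      (f - ContinuousMap.const _ (f ⟨0, le_rfl, hT.le⟩)))) a (Ioc 0 T) t := by
  have hn : ⌈α⌉₊ = 2 :=
    (Nat.ceil_eq_iff two_ne_zero).2 ⟨by simpa using hα₁, by simpa using hα₂⟩
  have h0 : derivWithin x (Icc 0 T) 0 = f ⟨0, le_rfl, hT.le⟩ :=
    derivWithin_Icc_eq hT hf ⟨0, le_rfl, hT.le⟩
  rw [HasCaputoDeriv, HasRLDeriv, hn]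
  simp only [Finset.sum_range_succ, Finset.sum_range_zero, zero_add, iteratedDerivWithin_zero,
    iteratedDerivWithin_one, pow_zero, Nat.factorial_zero, Nat.factorial_one, Nat.cast_one,
    Nat.cast_ofNat, div_one, one_smul, pow_one, h0, Nat.add_one_sub_one]
  set y0 := f ⟨0, le_rfl, hT.le⟩
  set D := f - ContinuousMap.const _ y0 with hD
  have hα : 0 ≤ 2 - α := sub_nonneg.2 hα₂
  have hmain {s : ℝ} (hs : s ∈ Ioc 0 T) :
      HasDerivWithinAt (fracIntegral (2 - α) fun s => x s - (x 0 + s • y0))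
        (rlIntegral hT.le (2 - α) D ⟨s, Ioc_subset_Icc_self hs⟩) (Ioc 0 T) s := by
    refine hasDerivWithinAt_of_eq_add_rlIntegral_one hT.le (c := 0) Ioc_subset_Icc_self
      (fun s hs => ?_) hs
    rw [zero_add, rlIntegral_comm hT.le zero_le_one hα]
    refine fracIntegral_eq_rlIntegral hT.le hα (Ioc_subset_Icc_self hs) fun r => ?_
    rw [hD, map_sub, ContinuousMap.sub_apply, rlIntegral_const hT.le zero_le_one, hf r,
      one_add_one_eq_two, Real.Gamma_two, Real.rpow_one, div_one]
    abel
  have hder : EqOn (derivWithin (fracIntegral (2 - α) fun s => x s - (x 0 + s • y0)) (Ioc 0 T))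
      (IccExtend hT.le (rlIntegral hT.le (2 - α) D)) (Ioc 0 T) := fun s hs => by
    rw [(hmain hs).derivWithin (uniqueDiffOn_Ioc 0 T s hs),
      IccExtend_of_mem _ _ (Ioc_subset_Icc_self hs)]
  constructor
  · rintro ⟨-, h⟩
    exact h.congr (fun s hs => (hder hs).symm) (hder ht).symm
  · intro h
    refine ⟨fun i hi => ?_, h.congr hder (hder ht)⟩
    obtain rfl : i = 0 := by omega
    rw [iteratedDerivWithin_zero]
    exact fun s hs => (hmain hs).differentiableWithinAt

/-- Iteration gives `u = I^1 ψ + A^n I^(nγ) u`; once `nγ ≥ 1`, the last term is `I^1` of the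
continuous function `A^n I^(nγ-1) u`. So `u` is `C¹` even when `γ < 1`. -/
theorem exists_eq_rlIntegral_one_of_eq_add (hT : 0 ≤ T) (A : Y →L[ℝ] Y) {γ : ℝ} (hγ : 0 < γ)
    {u φ : C(Icc 0 T, Y)} (h : u = rlIntegral hT 1 φ + rlIntegralComp hT A γ u) :
    ∃ ψ, u = rlIntegral hT 1 ψ := by
  have hcomm (n : ℕ) (f : C(Icc 0 T, Y)) :
      (rlIntegralComp hT A γ ^ n) (rlIntegral hT 1 f) =
        rlIntegral hT 1 ((rlIntegralComp hT A γ ^ n) f) := by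
    rw [rlIntegralComp_pow hT A hγ.le]
    change (A ^ n).compLeftContinuous ℝ (Icc 0 T) (rlIntegral hT (n * γ) (rlIntegral hT 1 f)) =
      rlIntegral hT 1 ((A ^ n).compLeftContinuous ℝ (Icc 0 T) (rlIntegral hT (n * γ) f))
    rw [rlIntegral_compLeft, rlIntegral_comm hT zero_le_one (by positivity)]
  have hiter (n : ℕ) : ∃ ψ, u = rlIntegral hT 1 ψ + (rlIntegralComp hT A γ ^ n) u := by
    induction n with
    | zero => exact ⟨0, by simp⟩
    | succ n ih =>
      obtain ⟨ψ, hψ⟩ := ih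
      refine ⟨ψ + (rlIntegralComp hT A γ ^ n) φ, ?_⟩
      have h2 : (rlIntegralComp hT A γ ^ n) u = rlIntegral hT 1 ((rlIntegralComp hT A γ ^ n) φ) +
          (rlIntegralComp hT A γ ^ (n + 1)) u := by
        conv_lhs => rw [h]
        rw [map_add, hcomm, pow_succ]; rfl
      conv_lhs => rw [hψ, h2]
      rw [map_add, add_assoc]
  obtain ⟨n, hn⟩ := exists_nat_ge (1 / γ)
  have hn1 : 1 ≤ n * γ := (div_le_iff₀ hγ).1 hn
  obtain ⟨ψ, hψ⟩ := hiter n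
  refine ⟨ψ + (A ^ n).compLeftContinuous ℝ (Icc 0 T) (rlIntegral hT (n * γ - 1) u), ?_⟩
  rw [map_add, rlIntegral_compLeft, rlIntegral_rlIntegral hT zero_le_one (sub_nonneg.2 hn1),
    add_sub_cancel]
  rw [rlIntegralComp_pow hT A hγ.le] at hψ
  exact hψ

end FracEvol
end

/-! ### Equivalence of the solution concepts with the Volterra equation. -/

noncomputable section

namespace FracEvol

variable {Y : Type*} [NormedAddCommGroup Y] [NormedSpace ℝ Y] [CompleteSpace Y] {T : ℝ}

/-- The Volterra equation for `u = x - η` in resolvent form, rewritten with the right-hand side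
`B x + g` collected under one fractional integral. -/
theorem resolvent_equation_iff (hT : 0 ≤ T) (A B : Y →L[ℝ] Y) (γ α : ℝ) (η η' : Y)
    (X G : C(Icc 0 T, Y)) :
    X - ContinuousMap.const _ η =
      (rlIntegral hT 1 (ContinuousMap.const _ η') +
        rlIntegral hT α (ContinuousMap.const _ (B η) + G)) +
        (rlIntegralComp hT A γ (X - ContinuousMap.const _ η) +
          rlIntegralComp hT B α (X - ContinuousMap.const _ η)) ↔
    X - ContinuousMap.const _ η = rlIntegral hT 1 (ContinuousMap.const _ η') +
      rlIntegralComp hT A γ (X - ContinuousMap.const _ η) +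
        rlIntegral hT α (B.compLeftContinuous ℝ (Icc 0 T) X + G) := by
  have h : rlIntegralComp hT B α (X - ContinuousMap.const _ η) =
      rlIntegral hT α (B.compLeftContinuous ℝ (Icc 0 T) (X - ContinuousMap.const _ η)) := by
    rw [rlIntegral_compLeft]; rfl
  have h2 : B.compLeftContinuous ℝ (Icc 0 T) X =
      B.compLeftContinuous ℝ (Icc 0 T) (X - ContinuousMap.const _ η) +
        ContinuousMap.const _ (B η) := by
    ext t
    change B (X t) = B (X t - η) + B η
    rw [← map_add, sub_add_cancel]
  rw [h, h2]
  simp only [map_add]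
  constructor <;> (intro h3; refine h3.trans ?_; abel)

theorem isMildSolution_iff (hT : 0 ≤ T) (A B : Y →L[ℝ] Y) {α β : ℝ} (hα : 0 < α) (hβα : β < α)
    (η η' : Y) {g x : ℝ → Y} {G X : C(Icc 0 T, Y)} (hG : ∀ s : Icc 0 T, g s = G s)
    (hX : ∀ s : Icc 0 T, x s = X s) :
    IsMildSolution A B α β T η η' g x ↔
      X - ContinuousMap.const _ η = rlIntegral hT 1 (ContinuousMap.const _ η') +
        rlIntegralComp hT A (α - β) (X - ContinuousMap.const _ η) +
          rlIntegral hT α (B.compLeftContinuous ℝ (Icc 0 T) X + G) := by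
  have hx : ContinuousOn x (Icc 0 T) := by
    rw [continuousOn_iff_continuous_domRestrict]
    exact X.continuous.congr fun t => (hX t).symm
  have hγ := sub_pos.2 hβα
  rw [IsMildSolution, and_iff_right hx, ContinuousMap.ext_iff]
  refine Subtype.forall'.trans (forall_congr' fun t => ?_)
  have h1 := fracIntegral_eq_rlIntegral hT hγ.le t.2 (x := fun r => A (x r))
    (f := A.compLeftContinuous ℝ (Icc 0 T) X) fun s => congrArg A (hX s)
  have h2 := fracIntegral_eq_rlIntegral hT hα.le t.2 (x := fun r => B (x r) + g r)
    (f := B.compLeftContinuous ℝ (Icc 0 T) X + G) fun s => by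
      rw [hX, hG]; rfl
  rw [fracIntegral, if_neg hγ.ne'] at h1
  rw [fracIntegral, if_neg hα.ne'] at h2
  rw [h1, h2, hX, rlIntegral_compLeft]
  -- The `A η` term of the mild equation is `A I^(α-β)` applied to the constant `η`.
  have h3 : rlIntegralComp hT A (α - β) (X - ContinuousMap.const _ η) t =
      A.compLeftContinuous ℝ (Icc 0 T) (rlIntegral hT (α - β) X) t -
        ((t : ℝ) ^ (α - β) / Real.Gamma (α - β + 1)) • A η := by
    rw [rlIntegralComp_apply, map_sub, ContinuousMap.sub_apply, rlIntegral_const hT hγ.le, map_sub,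
      map_smul]
    rfl
  simp only [ContinuousMap.sub_apply, ContinuousMap.add_apply, ContinuousMap.const_apply, h3,
    rlIntegral_const hT zero_le_one, one_add_one_eq_two, Real.Gamma_two, Real.rpow_one, div_one]
  rw [sub_eq_iff_eq_add]
  constructor <;> (intro h4; refine h4.trans ?_; abel)

theorem isSolution_iff (hT : 0 < T) (A B : Y →L[ℝ] Y) {α β : ℝ} (hα₁ : 1 < α) (hα₂ : α ≤ 2)
    (hβ₀ : 0 < β) (hβ₁ : β ≤ 1) (η η' : Y) {g x : ℝ → Y} {G X : C(Icc 0 T, Y)}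
    (hG : ∀ s : Icc 0 T, g s = G s) (hX : ∀ s : Icc 0 T, x s = X s) :
    IsSolution A B α β T η η' g x ↔
      X - ContinuousMap.const _ η = rlIntegral hT.le 1 (ContinuousMap.const _ η') +
        rlIntegralComp hT.le A (α - β) (X - ContinuousMap.const _ η) +
          rlIntegral hT.le α (B.compLeftContinuous ℝ (Icc 0 T) X + G) := by
  have hα : 0 ≤ 2 - α := sub_nonneg.2 hα₂
  have hα' : 0 ≤ α - 1 := sub_nonneg.2 hα₁.le
  have hβ : 0 ≤ 1 - β := sub_nonneg.2 hβ₁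
  have hγ : 0 < α - β := by linarith
  have hm0 : (0 : ℝ) ∈ Icc 0 T := ⟨le_rfl, hT.le⟩
  set h := B.compLeftContinuous ℝ (Icc 0 T) X + G
  have hht (t : Icc 0 T) : B (x t) + g t = h t := by rw [hX, hG]; rfl
  clear_value h
  constructor
  · rintro ⟨hC, hx0, hx1, heq⟩
    obtain ⟨f, hf⟩ := (contDiffOn_one_iff_exists_rlIntegral hT).1 hC
    have hf0 : f ⟨0, hm0⟩ = η' := by
      rw [← hx1]; exact (derivWithin_Icc_eq hT hf ⟨0, hm0⟩).symm
    have hU : X - ContinuousMap.const _ η = rlIntegral hT.le 1 f := by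
      ext t
      simp only [ContinuousMap.sub_apply, ContinuousMap.const_apply]
      rw [← hX, hf, hx0, add_sub_cancel_left]
    set D := f - ContinuousMap.const _ η' with hD
    -- A primitive of the left-hand side of the equation: `F(0) = 0` and `F' = h` on `(0, T]`, hence
    -- `F = I^1 h`. Applying `I^(α-1)` raises the orders to those of the Volterra equation.
    set F := rlIntegral hT.le (2 - α) D -
      A.compLeftContinuous ℝ (Icc 0 T) (rlIntegral hT.le 1 (rlIntegral hT.le (1 - β) f)) with hF
    have hF0 : F ⟨0, hm0⟩ = 0 := by
      have h1 : rlIntegral hT.le (2 - α) D ⟨0, hm0⟩ = 0 :=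
        rlIntegral_apply_zero_of_apply_zero hT.le hα D hm0 (by simp [hD, hf0])
      have h2 : A.compLeftContinuous ℝ (Icc 0 T)
          (rlIntegral hT.le 1 (rlIntegral hT.le (1 - β) f)) ⟨0, hm0⟩ = 0 := by
        refine (congrArg A (rlIntegral_apply_zero hT.le one_pos _ hm0)).trans (map_zero A)
      rw [hF, ContinuousMap.sub_apply, h1, h2, sub_zero]
    have hFh : F = rlIntegral hT.le 1 h := by
      ext t
      have h1 := eq_add_rlIntegral_one_of_hasDerivWithinAt hT.le (x := IccExtend hT.le F) (f := h)
        (F.continuous.Icc_extend' (h := hT.le)).continuousOn (fun s hs => ?_) t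
      · rw [IccExtend_val, IccExtend_of_mem _ _ hm0, hF0, zero_add] at h1
        exact h1
      · obtain ⟨a, b, ha, hb, hab⟩ := heq s hs
        rw [hasCaputoDeriv_iff_of_one_lt hT hα₁ hα₂ hf _ hs, hf0] at ha
        rw [hasCaputoDeriv_iff_of_le_one hT hβ₀ hβ₁ hf _ hs] at hb
        rw [← hht, ← hab, hb]
        have hJ := hasDerivWithinAt_of_eq_add_rlIntegral_one hT.le (c := 0)
          (x := IccExtend hT.le (rlIntegral hT.le 1 (rlIntegral hT.le (1 - β) f)))
          (Ioc_subset_Icc_self (a := 0) (b := T))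
          (fun r hr => by rw [IccExtend_of_mem _ _ (Ioc_subset_Icc_self hr), zero_add]) hs
        exact ha.sub (A.hasFDerivAt.comp_hasDerivWithinAt s hJ)
    have h1 := congrArg (rlIntegral hT.le (α - 1)) hFh
    rw [hF, map_sub, rlIntegral_compLeft, rlIntegral_rlIntegral hT.le hα' hα,
      rlIntegral_comm hT.le zero_le_one hβ, ← hU, rlIntegral_rlIntegral hT.le hα' hβ,
      rlIntegral_rlIntegral hT.le hα' zero_le_one, hD] at h1
    have e1 : α - 1 + (2 - α) = 1 := by ring
    have e2 : α - 1 + (1 - β) = α - β := by ring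
    rw [e1, e2, sub_add_cancel, map_sub, ← hU] at h1
    rw [← h1]
    have h2 : A.compLeftContinuous ℝ (Icc 0 T)
        (rlIntegral hT.le (α - β) (X - ContinuousMap.const _ η)) =
      rlIntegralComp hT.le A (α - β) (X - ContinuousMap.const _ η) := rfl
    rw [h2]
    abel
  · intro hV
    set U := X - ContinuousMap.const _ η with hUdef
    set φ := ContinuousMap.const _ η' + rlIntegral hT.le (α - 1) h with hφ
    have hJφ : rlIntegral hT.le 1 φ =
        rlIntegral hT.le 1 (ContinuousMap.const _ η') + rlIntegral hT.le α h := by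
      rw [hφ, map_add, rlIntegral_rlIntegral hT.le zero_le_one hα', add_sub_cancel]
    have hV' : U = rlIntegral hT.le 1 φ + rlIntegralComp hT.le A (α - β) U := by
      rw [hJφ]; refine hV.trans ?_; abel
    obtain ⟨f, hUf⟩ := exists_eq_rlIntegral_one_of_eq_add hT.le A hγ hV'
    -- The Volterra equation differentiated once, by cancelling `I^1`. Its value at 0 gives `x'(0) =
    -- η'`.
    have hfφ : f = φ + rlIntegralComp hT.le A (α - β) f := by
      refine rlIntegral_one_injective hT ?_
      have h1 : rlIntegral hT.le 1 (rlIntegralComp hT.le A (α - β) f) =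
          rlIntegralComp hT.le A (α - β) (rlIntegral hT.le 1 f) :=
        (rlIntegral_compLeft hT.le 1 A _).trans
          (congrArg _ (rlIntegral_comm hT.le zero_le_one hγ.le f))
      rw [map_add, h1, ← hUf]
      exact hV'
    have hx0 : x 0 = η := by
      have h1 : U ⟨0, hm0⟩ = 0 := by rw [hUf]; exact rlIntegral_apply_zero hT.le one_pos _ hm0
      rw [hUdef, ContinuousMap.sub_apply, ← hX] at h1
      exact sub_eq_zero.1 h1
    have hf : ∀ t : Icc 0 T, x t = x 0 + rlIntegral hT.le 1 f t := fun t => by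
      rw [← hUf, hx0, hX, hUdef, ContinuousMap.sub_apply, ContinuousMap.const_apply,
        add_sub_cancel]
    have hf0 : f ⟨0, hm0⟩ = η' := by
      rw [hfφ, hφ, ContinuousMap.add_apply, ContinuousMap.add_apply,
        rlIntegral_apply_zero hT.le (by linarith) _ hm0, rlIntegralComp_apply,
        rlIntegral_apply_zero hT.le hγ _ hm0, map_zero]
      simp
    refine ⟨(contDiffOn_one_iff_exists_rlIntegral hT).2 ⟨f, hf⟩, hx0,
      (derivWithin_Icc_eq hT hf ⟨0, hm0⟩).trans hf0, fun t ht => ?_⟩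
    have ht' := Ioc_subset_Icc_self ht
    refine ⟨h ⟨t, ht'⟩ + A (rlIntegral hT.le (1 - β) f ⟨t, ht'⟩),
      rlIntegral hT.le (1 - β) f ⟨t, ht'⟩, ?_,
      (hasCaputoDeriv_iff_of_le_one hT hβ₀ hβ₁ hf _ ht).2 rfl, ?_⟩
    · rw [hasCaputoDeriv_iff_of_one_lt hT hα₁ hα₂ hf _ ht, hf0]
      have h1 : f - ContinuousMap.const _ η' = rlIntegral hT.le (α - 1) h +
          A.compLeftContinuous ℝ (Icc 0 T) (rlIntegral hT.le (α - β) f) := by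
        have h2 := sub_eq_of_eq_add' (hfφ.trans (add_assoc _ _ _))
        exact h2
      have e1 : 2 - α + (α - 1) = 1 := by ring
      have e2 : 2 - α + (α - β) = 1 + (1 - β) := by ring
      -- Applying `I^(2-α)` brings both orders to at least 1, so an `I^1` factors out and the
      -- derivative of order `α` exists.
      have h3 : rlIntegral hT.le (2 - α) (f - ContinuousMap.const _ η') = rlIntegral hT.le 1
          (h + A.compLeftContinuous ℝ (Icc 0 T) (rlIntegral hT.le (1 - β) f)) := by
        rw [h1, map_add, map_add, rlIntegral_compLeft, rlIntegral_compLeft,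
          rlIntegral_rlIntegral hT.le hα hα', rlIntegral_rlIntegral hT.le hα hγ.le,
          rlIntegral_rlIntegral hT.le zero_le_one hβ, e1, e2]
      rw [h3]
      exact hasDerivWithinAt_of_eq_add_rlIntegral_one hT.le (c := 0)
        (f := h + A.compLeftContinuous ℝ (Icc 0 T) (rlIntegral hT.le (1 - β) f))
        (Ioc_subset_Icc_self (a := 0) (b := T))
        (fun r hr => by rw [IccExtend_of_mem _ _ (Ioc_subset_Icc_self hr), zero_add]) ht
    · rw [add_sub_cancel_right]
      exact (hht ⟨t, ht'⟩).symm

/-- For `x' = f` and `x'' = f₂`, `I^(2-α) (f - f(0)) = I^1 I^(2-α) f₂`, so the derivative of order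
`α` exists automatically and has the classical value. -/
theorem isClassicalSolution_iff_isSolution (hT : 0 < T) (A B : Y →L[ℝ] Y) {α β : ℝ} (hα₁ : 1 < α)
    (hα₂ : α ≤ 2) (hβ₀ : 0 < β) (hβ₁ : β ≤ 1) (η η' : Y) (g : ℝ → Y) {x : ℝ → Y}
    (hx : ContDiffOn ℝ 2 x (Icc 0 T)) :
    IsClassicalSolution A B α β T η η' g x ↔ IsSolution A B α β T η η' g x := by
  have hα : 0 ≤ 2 - α := sub_nonneg.2 hα₂
  have hβ : 0 ≤ 1 - β := sub_nonneg.2 hβ₁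
  have hm0 : (0 : ℝ) ∈ Icc 0 T := ⟨le_rfl, hT.le⟩
  have hu := uniqueDiffOn_Icc hT
  have hx1 : ContDiffOn ℝ 1 x (Icc 0 T) := hx.of_le one_le_two
  obtain ⟨f, hf⟩ := (contDiffOn_one_iff_exists_rlIntegral hT).1 hx1
  have hfd := derivWithin_Icc_eq hT hf
  have hx' : ContDiffOn ℝ 1 (derivWithin x (Icc 0 T)) (Icc 0 T) := by
    rw [← one_add_one_eq_two, contDiffOn_succ_iff_derivWithin hu] at hx
    exact hx.2.2
  obtain ⟨f₂, hf₂⟩ := (contDiffOn_one_iff_exists_rlIntegral hT).1 hx'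
  have hfd₂ := derivWithin_Icc_eq hT hf₂
  have hff₂ : f - ContinuousMap.const _ (f ⟨0, hm0⟩) = rlIntegral hT.le 1 f₂ := by
    ext t
    have h1 := hf₂ t
    rw [hfd t, hfd ⟨0, hm0⟩] at h1
    rw [ContinuousMap.sub_apply, h1]
    exact add_sub_cancel_left _ _
  have hnα : ⌈α⌉₊ = 2 :=
    (Nat.ceil_eq_iff two_ne_zero).2 ⟨by simpa using hα₁, by simpa using hα₂⟩
  have hnβ : ⌈β⌉₊ = 1 := (Nat.ceil_eq_iff one_ne_zero).2 ⟨by simpa using hβ₀, by simpa using hβ₁⟩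
  have hcα {t : ℝ} (ht : t ∈ Icc 0 T) :
      classicalCaputoDeriv T α x t = rlIntegral hT.le (2 - α) f₂ ⟨t, ht⟩ := by
    rw [classicalCaputoDeriv, hnα, Nat.cast_ofNat]
    refine fracIntegral_eq_rlIntegral hT.le hα ht fun s => ?_
    rw [iteratedDerivWithin_succ, iteratedDerivWithin_one]
    exact hfd₂ s
  have hcβ {t : ℝ} (ht : t ∈ Icc 0 T) :
      classicalCaputoDeriv T β x t = rlIntegral hT.le (1 - β) f ⟨t, ht⟩ := by
    rw [classicalCaputoDeriv, hnβ, Nat.cast_one]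
    refine fracIntegral_eq_rlIntegral hT.le hβ ht fun s => ?_
    rw [iteratedDerivWithin_one]
    exact hfd s
  have hC {t : ℝ} (ht : t ∈ Ioc 0 T) (a : Y) :
      HasCaputoDeriv T α x a t ↔ a = classicalCaputoDeriv T α x t := by
    have h1 : HasDerivWithinAt (IccExtend hT.le (rlIntegral hT.le (2 - α)
        (f - ContinuousMap.const _ (f ⟨0, hm0⟩))))
        (rlIntegral hT.le (2 - α) f₂ ⟨t, Ioc_subset_Icc_self ht⟩) (Ioc 0 T) t := by
      rw [hff₂, rlIntegral_comm hT.le hα zero_le_one]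
      exact hasDerivWithinAt_of_eq_add_rlIntegral_one hT.le (c := 0)
        (Ioc_subset_Icc_self (a := 0) (b := T))
        (fun r hr => by rw [IccExtend_of_mem _ _ (Ioc_subset_Icc_self hr), zero_add]) ht
    rw [hasCaputoDeriv_iff_of_one_lt hT hα₁ hα₂ hf _ ht, hcα (Ioc_subset_Icc_self ht)]
    constructor
    · exact fun h => (uniqueDiffOn_Ioc 0 T t ht).eq_deriv _ h h1
    · rintro rfl
      exact h1
  rw [IsClassicalSolution, IsSolution, and_iff_right hx1]
  refine and_congr_right' (and_congr_right' (forall₂_congr fun t ht => ?_))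
  simp only [hC ht, hasCaputoDeriv_iff_of_le_one hT hβ₀ hβ₁ hf _ ht,
    ← hcβ (Ioc_subset_Icc_self ht)]
  simp

theorem resolvent_equation_iff_eqOn_permFormula (hT : 0 ≤ T) {A B : Y →L[ℝ] Y} (hAB : Commute A B)
    {α β : ℝ} (hα : 1 ≤ α) (hβ : 0 ≤ β) (hβα : β < α) (η η' : Y) {g x : ℝ → Y}
    {G X : C(Icc 0 T, Y)} (hG : ∀ s : Icc 0 T, g s = G s) (hX : ∀ s : Icc 0 T, x s = X s) :
    X - ContinuousMap.const _ η = rlIntegral hT 1 (ContinuousMap.const _ η') +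
        rlIntegralComp hT A (α - β) (X - ContinuousMap.const _ η) +
          rlIntegral hT α (B.compLeftContinuous ℝ (Icc 0 T) X + G) ↔
      EqOn x (permFormula A B α β η η' g) (Icc 0 T) := by
  rw [← resolvent_equation_iff, eq_resolventSeries_apply_iff hT hAB (sub_pos.2 hβα)
    (sub_le_self _ hβ), ContinuousMap.ext_iff]
  refine (forall_congr' fun t => ?_).trans Subtype.forall'.symm
  rw [permFormula_eq_add_resolventSeries hT A B hα hβ hβα η η' G hG t, hX,
    ContinuousMap.sub_apply, ContinuousMap.const_apply, sub_eq_iff_eq_add']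

theorem continuousOn_permFormula (hT : 0 ≤ T) (A B : Y →L[ℝ] Y) {α β : ℝ} (hα : 1 ≤ α)
    (hβ : 0 ≤ β) (hβα : β < α) (η η' : Y) {g : ℝ → Y} (hg : ContinuousOn g (Icc 0 T)) :
    ContinuousOn (permFormula A B α β η η' g) (Icc 0 T) := by
  obtain ⟨G, hG⟩ := exists_continuousMap_eq hg
  rw [continuousOn_iff_continuous_domRestrict]
  exact (continuous_const.add (ContinuousMap.continuous _)).congr fun t =>
    (permFormula_eq_add_resolventSeries hT A B hα hβ hβα η η' G hG t).symm

end FracEvol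
end

theorem mainTheorem9 {Y : Type*} [NormedAddCommGroup Y] [NormedSpace ℝ Y] [CompleteSpace Y]
    (A B : Y →L[ℝ] Y) (hAB : A * B - B * A = 0)
    (α β T : ℝ) (hα₁ : 1 < α) (hα₂ : α ≤ 2) (hβ₀ : 0 < β) (hβ₁ : β ≤ 1) (hT : 0 < T)
    (η η' : Y) (g : ℝ → Y) (hg : ContinuousOn g (Icc 0 T)) :
    -- the double series converge absolutely in operator norm and the integral exists
    (∀ δ ∈ ({α, 1, α - 1} : Set ℝ), ∀ t ∈ Icc 0 T,
      Summable fun p : ℕ × ℕ => ‖FracEvol.permTerm A B α β δ t p.1 p.2‖) ∧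
    (∀ t ∈ Icc 0 T, IntervalIntegrable
      (fun s => FracEvol.permSeries A B α β (α - 1) (t - s) (g s)) volume 0 t) ∧
    -- the formula gives a solution, and every solution is given by it
    (∀ x : ℝ → Y, FracEvol.IsSolution A B α β T η η' g x ↔
      EqOn x (FracEvol.permFormula A B α β η η' g) (Icc 0 T)) ∧
    -- the same for mild solutions
    (∀ x : ℝ → Y, FracEvol.IsMildSolution A B α β T η η' g x ↔
      EqOn x (FracEvol.permFormula A B α β η η' g) (Icc 0 T)) ∧
    -- the twice continuously differentiable case, with the classical Caputo derivatives
    (∀ x : ℝ → Y, ContDiffOn ℝ 2 x (Icc 0 T) →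
      (FracEvol.IsClassicalSolution A B α β T η η' g x ↔
        EqOn x (FracEvol.permFormula A B α β η η' g) (Icc 0 T))) := by
  have hβα : β < α := hβ₁.trans_lt hα₁
  have hc : Commute A B := sub_eq_zero.1 hAB
  obtain ⟨G, hG⟩ := FracEvol.exists_continuousMap_eq hg
  have hform := FracEvol.continuousOn_permFormula hT.le A B hα₁.le hβ₀.le hβα η η' hg
  have hsol (x : ℝ → Y) (hx : ContinuousOn x (Icc 0 T)) :
      FracEvol.IsSolution A B α β T η η' g x ↔
        EqOn x (FracEvol.permFormula A B α β η η' g) (Icc 0 T) := by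
    obtain ⟨X, hX⟩ := FracEvol.exists_continuousMap_eq hx
    rw [FracEvol.isSolution_iff hT A B hα₁ hα₂ hβ₀ hβ₁ η η' hG hX,
      FracEvol.resolvent_equation_iff_eqOn_permFormula hT.le hc hα₁.le hβ₀.le hβα η η' hG hX]
  have hmild (x : ℝ → Y) (hx : ContinuousOn x (Icc 0 T)) :
      FracEvol.IsMildSolution A B α β T η η' g x ↔
        EqOn x (FracEvol.permFormula A B α β η η' g) (Icc 0 T) := by
    obtain ⟨X, hX⟩ := FracEvol.exists_continuousMap_eq hx
    rw [FracEvol.isMildSolution_iff hT.le A B (by linarith) hβα η η' hG hX,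
      FracEvol.resolvent_equation_iff_eqOn_permFormula hT.le hc hα₁.le hβ₀.le hβα η η' hG hX]
  refine ⟨fun δ hδ t ht => ?_, fun t ht => ?_, fun x => ?_, fun x => ?_, fun x hx => ?_⟩
  · refine FracEvol.summable_norm_permTerm A B hβ₀.le hβα ?_ ht.1
    rcases hδ with rfl | rfl | rfl <;> linarith
  · refine ContinuousOn.intervalIntegrable ?_
    rw [uIcc_of_le ht.1]
    exact FracEvol.continuousOn_permSeries_apply A B hβ₀.le hβα (by linarith) ht.1
      (hg.mono (Icc_subset_Icc_right ht.2))
  -- The continuity that `hsol` requires comes from the solution in one direction, from the formula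
  -- in the other.
  · exact ⟨fun h => (hsol x h.1.continuousOn).1 h, fun h => (hsol x (hform.congr h)).2 h⟩
  · exact ⟨fun h => (hmild x h.1).1 h, fun h => (hmild x (hform.congr h)).2 h⟩
  · rw [FracEvol.isClassicalSolution_iff_isSolution hT A B hα₁ hα₂ hβ₀ hβ₁ η η' g hx,
      hsol x hx.continuousOn]
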